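/- **Theorem 3.6.** Let $d\ne 1$ be a squarefree integer, $K=\mathbb{Q}(\sqrt d)$ with ring of integers $\mathcal{O}_K$, and put $\omega=\frac{1+\sqrt d}{2}$, $d_K=d$ if $d\equiv 1 \bmod 4$, and $\omega=\sqrt d$, $d_K=4d$ otherwise (with $\sqrt{d_K}=\sqrt d$, resp. $\sqrt{d_K}=2\sqrt d$). Let $\mathcal{O}$ be an order in $K$ (a subring of $\mathcal{O}_K$ with quotient field $K$ over which $\mathcal{O}_K$ is a finitely generated module) with conductor $\{x\in K\mid x\mathcal{O}_K\subseteq\mathcal{O}\}=f\mathcal{O}_K$, where $f\ge 2$ is an integer. Let $\varepsilon\in\{0,1\}$ with $\varepsilon\equiv f d_K \bmod 2$, and $\tau=\frac{\varepsilon+f\sqrt{d_K}}{2}$. Let $p$ be a prime divisor of $f$, $v=\mathrm{v}_p(f)$, $\mathfrak{p}=p\mathbb{Z}+f\omega\mathbb{Z}$ (an ideal of $\mathcal{O}$), and let $N=\mathcal{N}_{K/\mathbb{Q}}$ denote the norm. An *ideal atom* is an atom (irreducible element) of the monoid of nonzero ideals of $\mathcal{O}$ under multiplication. The prime $p$ is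 *inert* if $p\mathcal{O}_K$ is prime, *split* if $p\mathcal{O}_K$ is a product of two distinct prime ideals, and *ramified* if $p\mathcal{O}_K$ is the square of a prime ideal. 1. The primary ideals of $\mathcal{O}$ with radical $\mathfrak{p}$ are exactly the sets $\mathfrak{q}=p^\ell(p^m\mathbb{Z}+(r+\tau)\mathbb{Z})$ with integers $\ell,m\ge 0$, $\ell+m\ge 1$, $0\le r<p^m$ and $N(r+\tau)\equiv 0 \bmod p^m$ (all of these are ideals). Moreover $|\mathcal{O}/\mathfrak{q}|=p^{2\ell+m}$. 2. Let $\mathfrak{q}=p^\ell(p^m\mathbb{Z}+(r+\tau)\mathbb{Z})$, with integers $\ell,m\ge 0$ and $r$, be a primary ideal with radical $\mathfrak{p}$. If $m\ge 1$, then $\mathfrak{q}$ is invertible if and only if $N(r+\tau)\not\equiv 0 \bmod p^{m+1}$. If $m=0$, then $\mathfrak{q}$ is invertible. 3. A primary ideal $\mathfrak{q}$ with radical $\mathfrak{p}$ is an ideal atom if and only if $\mathfrak{q}=p\mathcal{O}$ or $\mathfrak{q}=p^m\mathbb{Z}+(r+\tau)\mathbb{Z}$ for some integers $m\ge 1$ and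 $r$ with $p^m\mid N(r+\tau)$. 4. For an integer $m\ge 0$ let $A_m$ be the number of invertible ideal atoms of norm $p^m$ (that is, with $|\mathcal{O}/\mathfrak{q}|=p^m$) which are of the form $\mathfrak{q}=p^m\mathbb{Z}+(r+\tau)\mathbb{Z}$ with $r\in\mathbb{Z}$. Then, with $\varphi$ denoting Euler's function: - $A_{2h}=\varphi(p^h)$ for $1\le h<v$, and $A_m=0$ for all other $m<2v$; - if $p$ is inert, then $A_{2v}=p^v$ and $A_m=0$ for all $m\ge 2v+1$; - if $p$ is ramified, then $A_{2v}=\varphi(p^v)$, $A_{2v+1}=p^v$ and $A_m=0$ for all $m>2v+1$; - if $p$ is split, then $A_{2v}=p^{v-1}(p-2)$ and $A_m=2\varphi(p^v)$ for all $m\ge 2v+1$. 5. The number of ideal atoms with radical $\mathfrak{p}$ is finite if and only if the number of invertible ideal atoms with radical $\mathfrak{p}$ is finite, if and only if $p$ is not split. -/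

import Mathlib

open scoped nonZeroDivisors

noncomputable section

namespace QuadOrder

/-- The discriminant `d_K` of `ℚ(√d)`, for `d` squarefree. -/
def dK (d : ℤ) : ℤ := if d % 4 = 1 then d else 4 * d

/-- `ε ∈ {0, 1}` with `ε ≡ f d_K mod 2`. -/
def eps (d : ℤ) (f : ℕ) : ℤ := ((f : ℤ) * dK d) % 2

section Field

variable {K : Type*} [Field K]

/-- `√d_K`, expressed through a square root `δ` of `d`. -/
def sqrtDK (d : ℤ) (δ : K) : K := if d % 4 = 1 then δ else 2 * δ

/-- `ω = (1 + √d) / 2` if `d ≡ 1 mod 4`, and `ω = √d` otherwise; `δ` is a square root of `d`. -/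
def omega (d : ℤ) (δ : K) : K := if d % 4 = 1 then (1 + δ) / 2 else δ

/-- `τ = (ε + f √d_K) / 2`. -/
def tau (d : ℤ) (δ : K) (f : ℕ) : K := ((eps d f : K) + (f : K) * sqrtDK d δ) / 2

/-- The set `aℤ + bℤ`. -/
def lattice (a b : K) : Set K := {x | ∃ s t : ℤ, x = a * s + b * t}

/-- The set `p^ℓ (p^m ℤ + (r + τ) ℤ)`. -/
def primaryLattice (p : ℕ) (τ : K) (l m : ℕ) (r : ℤ) : Set K :=
  {x | ∃ y ∈ lattice ((p : K) ^ m) ((r : K) + τ), x = (p : K) ^ l * y}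

/-- `O` is an order in the maximal order `O_K`: it is a subring of `O_K` with quotient field `K`,
and `O_K` is a finitely generated `O`-module. -/
structure IsOrder (O : Subring K) : Prop where
  le : O ≤ (integralClosure ℤ K).toSubring
  quotient_field : ∀ x : K, ∃ a ∈ O, ∃ b ∈ O, b ≠ 0 ∧ x = a / b
  finite : ∃ S : Finset K, (Submodule.span O (S : Set K) : Set K) = {x : K | IsIntegral ℤ x}

/-- The conductor `(O : O_K) = {x ∈ K | x O_K ⊆ O}`. -/
def conductor (O : Subring K) : Set K := {x | ∀ y : K, IsIntegral ℤ y → x * y ∈ O}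

/-- The conductor of `O` is `f O_K`. -/
def HasConductor (O : Subring K) (f : ℕ) : Prop :=
  conductor O = {x : K | ∃ y : K, IsIntegral ℤ y ∧ x = (f : K) * y}

/-- `N_{K/ℚ}(x) ≡ 0 mod n`: the norm is an integer multiple of `n`. -/
def NormDvd [NumberField K] (n : ℕ) (x : K) : Prop :=
  ∃ k : ℤ, Algebra.norm ℚ x = ((n : ℚ) * (k : ℚ))

/-- An ideal of a subring of `K`, as a subset of `K`. -/
def carrier {O : Subring K} (I : Ideal O) : Set K := Subtype.val '' (I : Set O)

end Field

/-- An ideal of a domain is invertible if it is a unit among the fractional ideals. -/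
def Invertible {R : Type*} [CommRing R] [IsDomain R] (I : Ideal R) : Prop :=
  IsUnit (I : FractionalIdeal R⁰ (FractionRing R))

/-- Atoms of the monoid of nonzero ideals of a domain. (The factors of a nonzero ideal are nonzero,
so irreducibility among all ideals is irreducibility among the nonzero ones.) -/
def IsIdealAtom {R : Type*} [CommRing R] [IsDomain R] (I : Ideal R) : Prop :=
  I ≠ ⊥ ∧ Irreducible I

/-- The norm `|R / I|` of an ideal. -/
def idealNorm {R : Type*} [CommRing R] (I : Ideal R) : ℕ := Nat.card (R ⧸ I)

section Splitting

variable (K : Type*) [Field K] [NumberField K]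

/-- The ideal `p O_K`. -/
def extended (p : ℕ) : Ideal (NumberField.RingOfIntegers K) :=
  Ideal.span {(p : NumberField.RingOfIntegers K)}

/-- `p O_K` is a prime ideal. -/
def Inert (p : ℕ) : Prop := (extended K p).IsPrime

/-- `p O_K` is a product of two distinct prime ideals. -/
def Splits (p : ℕ) : Prop :=
  ∃ P Q : Ideal (NumberField.RingOfIntegers K), P.IsPrime ∧ Q.IsPrime ∧ P ≠ Q ∧
    extended K p = P * Q

/-- `p O_K` is the square of a prime ideal. -/
def Ramified (p : ℕ) : Prop :=
  ∃ P : Ideal (NumberField.RingOfIntegers K), P.IsPrime ∧ extended K p = P ^ 2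

end Splitting

/-- The invertible ideal atoms of the form `p^m ℤ + (r + τ) ℤ` with norm `p^m`. -/
def invAtoms {K : Type*} [Field K] (O : Subring K) (p : ℕ) (τ : K) (m : ℕ) : Set (Ideal O) :=
  {I | IsIdealAtom I ∧ Invertible I ∧ idealNorm I = p ^ m ∧
    ∃ r : ℤ, carrier I = primaryLattice p τ 0 m r}

end QuadOrder

end

namespace QuadOrder

/-! Write θ = fω. The conductor condition forces O = ℤ + θℤ, with θ² = Tθ - N for T = f·Tr(ω) and N
= f²·N(ω). Since τ differs from θ by an integer, r + τ becomes x + θ, whose norm is the value x² +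
Tx + N of `normForm`. As p divides f, p ∣ T and p² ∣ N, and this drives the ideal theory.

An ideal has radical 𝔭 exactly when it is proper and contains a power of p, because 𝔭 is maximal and
θ is nilpotent modulo p. A Hermite normal form turns such an ideal into p^l(p^m ℤ + (x+θ)ℤ), and
closure under multiplication by θ amounts to p^m ∣ N(x+θ) (`exists_isLattice_of_pow_mem`,
`exists_isLattice`). If p^m divides the norm exactly, the product with the conjugate lattice is
principal (`mul_conj_eq`). If p^(m+1) also divides it and m ≥ 1, the conjugate of x + θ multiplies q
into pq without lying in pO, so q cannot be cancelled (`not_invertible`). Proper factors lie in 𝔭,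
and 𝔭² ⊆ p𝔭, so every lattice with l = 0 and m ≥ 1, and pO itself, is an atom. If l ≥ 1, the factor
pO splits off.

Invertible atoms of norm p^m with l = 0 thus correspond to residues x mod p^m at which the form has
valuation exactly m. With f = p^v g, p ∤ g, the form is x² + p^v T'x + p^(2v) N'. If x = p^j w with
j < v and p ∤ w, the valuation is 2j. If x = p^v u, it is 2v plus that of u² + T'u + N'. The latter
has no root mod p in the inert case. In the ramified case it has a double root that does not lift
mod p², since otherwise (u + gω)/p would be integral. In the split case it has two simple roots,
which lift by Hensel. Hence the valuation is unbounded, and there are infinitely many atoms, exactly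
when p splits. -/

/-- The value at `x` of the form `x² + T x + N`. -/
def normForm (T N x : ℤ) : ℤ := x ^ 2 + T * x + N

/-- The residues `x` modulo `p ^ m` such that `p ^ m` exactly divides `x² + T x + N`. -/
noncomputable def exactResidues (p : ℕ) (T N : ℤ) (m : ℕ) : Finset ℤ :=
  (Finset.Ico 0 ((p : ℤ) ^ m)).filter
    fun x => (p : ℤ) ^ m ∣ normForm T N x ∧ ¬ (p : ℤ) ^ (m + 1) ∣ normForm T N x

/-- The residues `u` modulo `p ^ (k + v)` such that `p ^ k` exactly divides `u² + T u + N`. -/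
noncomputable def exactLifts (p : ℕ) (T N : ℤ) (v k : ℕ) : Finset ℤ :=
  (Finset.Ico 0 ((p : ℤ) ^ (k + v))).filter
    fun u => (p : ℤ) ^ k ∣ normForm T N u ∧ ¬ (p : ℤ) ^ (k + 1) ∣ normForm T N u

/-! ### Counting residues with prescribed valuation of the form. -/

theorem normForm_scale (T N u : ℤ) (a : ℤ) :
    normForm (a * T) (a ^ 2 * N) (a * u) = a ^ 2 * normForm T N u := by
  unfold normForm; ring

theorem card_Ico_filter_dvd_sub {p : ℕ} (hp : p.Prime) {j k : ℕ} (hjk : j ≤ k) (a : ℤ) :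
    ((Finset.Ico 0 ((p : ℤ) ^ k)).filter fun u => (p : ℤ) ^ j ∣ u - a).card = p ^ (k - j) := by
  have hpos : (0 : ℤ) < (p : ℤ) ^ j := pow_pos (by exact_mod_cast hp.pos) j
  have h := Int.Ico_filter_modEq_card 0 ((p : ℤ) ^ k) hpos a
  have hset : ((Finset.Ico 0 ((p : ℤ) ^ k)).filter fun u => (p : ℤ) ^ j ∣ u - a) =
      (Finset.Ico 0 ((p : ℤ) ^ k)).filter (fun u => u ≡ a [ZMOD (p : ℤ) ^ j]) := by
    refine Finset.filter_congr fun u _ => ?_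
    rw [Int.modEq_comm, Int.modEq_iff_dvd]
  rw [hset]
  obtain ⟨i, rfl⟩ := Nat.exists_eq_add_of_le hjk
  have hne : (((p : ℤ) ^ j : ℤ) : ℚ) ≠ 0 := by exact_mod_cast hpos.ne'
  -- The count is a difference of two ceilings. The interval length is a multiple of the modulus, so
  -- they differ by exactly p^i.
  have e : (((p : ℤ) ^ (j + i) : ℤ) - a : ℚ) / (((p : ℤ) ^ j : ℤ) : ℚ) =
      ((0 : ℤ) - a : ℚ) / (((p : ℤ) ^ j : ℤ) : ℚ) + (((p : ℤ) ^ i : ℤ) : ℚ) := by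
    rw [pow_add]; push_cast at hne ⊢; field_simp; ring
  rw [e, Int.ceil_add_intCast, add_sub_cancel_left,
    max_eq_left (pow_nonneg (by exact_mod_cast hp.pos.le) i)] at h
  rw [Nat.add_sub_cancel_left]
  exact_mod_cast h

theorem card_Ico_zero_pow (p k : ℕ) : (Finset.Ico 0 ((p : ℤ) ^ k)).card = p ^ k := by
  rw [Int.card_Ico, sub_zero, ← Nat.cast_pow, Int.toNat_natCast]

theorem card_Ico_filter_not_dvd_sub {p : ℕ} (hp : p.Prime) {k : ℕ} (hk : 1 ≤ k) (a : ℤ) :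
    ((Finset.Ico 0 ((p : ℤ) ^ k)).filter fun u => ¬ (p : ℤ) ∣ u - a).card =
      Nat.totient (p ^ k) := by
  have h1 := card_Ico_filter_dvd_sub hp hk a
  have h2 := Finset.card_filter_add_card_filter_not (s := Finset.Ico 0 ((p : ℤ) ^ k))
    (fun u => (p : ℤ) ∣ u - a)
  rw [pow_one] at h1
  rw [card_Ico_zero_pow, h1] at h2
  obtain ⟨i, rfl⟩ := Nat.exists_eq_add_of_le' hk
  rw [Nat.totient_prime_pow_succ hp, Nat.mul_sub, ← pow_succ, mul_one]
  simp only [Nat.add_sub_cancel] at h2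
  omega

theorem exists_eq_pow_mul_of_not_pow_dvd {p : ℕ} (hp : p.Prime) {v : ℕ} {x : ℤ}
    (h : ¬ (p : ℤ) ^ v ∣ x) : ∃ j < v, ∃ w, x = (p : ℤ) ^ j * w ∧ ¬ (p : ℤ) ∣ w := by
  have hx : x ≠ 0 := fun h0 => h (h0 ▸ dvd_zero _)
  have hfin : FiniteMultiplicity (p : ℤ) x := by
    rw [Int.finiteMultiplicity_iff]
    exact ⟨by simpa using hp.one_lt.ne', hx⟩
  obtain ⟨w, hw, hnw⟩ := hfin.exists_eq_pow_mul_and_not_dvd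
  refine ⟨_, ?_, w, hw, hnw⟩
  by_contra hlt
  exact h (hw ▸ (pow_dvd_pow _ (not_lt.mp hlt)).mul_right w)

/-- As j < v, the linear and constant terms have valuation above 2j, so x² = p^(2j) w² decides. -/
theorem pow_dvd_normForm_iff {p : ℕ} (hp : p.Prime) {j v : ℕ} (hj : j < v) (T N : ℤ) {w : ℤ}
    (hw : ¬ (p : ℤ) ∣ w) (i : ℕ) :
    (p : ℤ) ^ i ∣ normForm ((p : ℤ) ^ v * T) ((p : ℤ) ^ (2 * v) * N) ((p : ℤ) ^ j * w) ↔
      i ≤ 2 * j := by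
  have hpp : Prime (p : ℤ) := Nat.prime_iff_prime_int.mp hp
  obtain ⟨k, rfl⟩ := Nat.exists_eq_add_of_lt hj
  have e : normForm ((p : ℤ) ^ (j + k + 1) * T) ((p : ℤ) ^ (2 * (j + k + 1)) * N)
      ((p : ℤ) ^ j * w) = (p : ℤ) ^ (2 * j) *
        (w ^ 2 + p * ((p : ℤ) ^ k * T * w + (p : ℤ) ^ (2 * k + 1) * N)) := by
    unfold normForm; ring
  rw [e]
  constructor
  · intro h
    by_contra hlt
    have h1 : (p : ℤ) ^ (2 * j) * p ∣ (p : ℤ) ^ (2 * j) *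
        (w ^ 2 + p * ((p : ℤ) ^ k * T * w + (p : ℤ) ^ (2 * k + 1) * N)) := by
      rw [← pow_succ]; exact (pow_dvd_pow _ (by omega)).trans h
    have h2 := Int.dvd_of_mul_dvd_mul_left (pow_ne_zero _ hpp.ne_zero) h1
    exact hw (hpp.dvd_of_dvd_pow ((dvd_add_left (dvd_mul_right _ _)).mp h2))
  · intro h
    exact (pow_dvd_pow _ h).mul_right _

/-- The residues are the p^h w with w a unit mod p^h: multiples of p^v have a value divisible by
p^(2v), which is too much, and otherwise the valuation of x is half that of the value. -/
theorem card_exactResidues_two_mul {p : ℕ} (hp : p.Prime) {h v : ℕ} (h1 : 1 ≤ h) (hv : h < v)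
    (T N : ℤ) :
    (exactResidues p ((p : ℤ) ^ v * T) ((p : ℤ) ^ (2 * v) * N) (2 * h)).card =
      Nat.totient (p ^ h) := by
  have hpos : (0 : ℤ) < (p : ℤ) ^ h := pow_pos (by exact_mod_cast hp.pos) h
  rw [← card_Ico_filter_not_dvd_sub hp h1 0]
  symm
  refine Finset.card_bij (fun w _ => (p : ℤ) ^ h * w) ?_ ?_ ?_
  · intro w hw
    simp only [Finset.mem_filter, Finset.mem_Ico, sub_zero] at hw
    simp only [exactResidues, Finset.mem_filter, Finset.mem_Ico,
      pow_dvd_normForm_iff hp hv T N hw.2]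
    refine ⟨⟨mul_nonneg hpos.le hw.1.1, ?_⟩, le_rfl, by omega⟩
    rw [two_mul, pow_add]
    exact mul_lt_mul_of_pos_left hw.1.2 hpos
  · intro a _ b _ hab
    exact mul_left_cancel₀ hpos.ne' hab
  · intro x hx
    simp only [exactResidues, Finset.mem_filter, Finset.mem_Ico] at hx
    by_cases hxv : (p : ℤ) ^ v ∣ x
    · obtain ⟨u, rfl⟩ := hxv
      refine absurd ?_ hx.2.2
      rw [mul_comm 2 v, pow_mul, normForm_scale, ← pow_mul]
      exact (pow_dvd_pow _ (by omega)).mul_right _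
    · obtain ⟨j, hj, w, rfl, hw⟩ := exists_eq_pow_mul_of_not_pow_dvd hp hxv
      simp only [pow_dvd_normForm_iff hp hj T N hw] at hx
      obtain rfl : j = h := by omega
      refine ⟨w, ?_, rfl⟩
      simp only [Finset.mem_filter, Finset.mem_Ico, sub_zero]
      refine ⟨⟨nonneg_of_mul_nonneg_right hx.1.1 hpos, ?_⟩, hw⟩
      have := hx.1.2
      rw [two_mul, pow_add] at this
      exact lt_of_mul_lt_mul_left this hpos.le

theorem exactResidues_eq_empty {p : ℕ} (hp : p.Prime) {m v : ℕ} (hm : 1 ≤ m) (hmv : m < 2 * v)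
    (hne : ∀ h : ℕ, 1 ≤ h → h < v → m ≠ 2 * h) (T N : ℤ) :
    exactResidues p ((p : ℤ) ^ v * T) ((p : ℤ) ^ (2 * v) * N) m = ∅ := by
  rw [Finset.eq_empty_iff_forall_notMem]
  intro x hx
  simp only [exactResidues, Finset.mem_filter, Finset.mem_Ico] at hx
  by_cases hxv : (p : ℤ) ^ v ∣ x
  · obtain ⟨u, rfl⟩ := hxv
    refine absurd ?_ hx.2.2
    rw [mul_comm 2 v, pow_mul, normForm_scale, ← pow_mul]
    exact (pow_dvd_pow _ (by omega)).mul_right _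
  · obtain ⟨j, hj, w, rfl, hw⟩ := exists_eq_pow_mul_of_not_pow_dvd hp hxv
    simp only [pow_dvd_normForm_iff hp hj T N hw] at hx
    exact hne j (by omega) hj (by omega)

/-- A valuation of at least 2v forces x = p^v u. Dividing the range p^(2v+k) by p^v is the reason
for the modulus p^(k+v) in `exactLifts`. -/
theorem card_exactResidues_add {p : ℕ} (hp : p.Prime) (v k : ℕ) (T N : ℤ) :
    (exactResidues p ((p : ℤ) ^ v * T) ((p : ℤ) ^ (2 * v) * N) (2 * v + k)).card =
      (exactLifts p T N v k).card := by
  have hpos : (0 : ℤ) < (p : ℤ) ^ v := pow_pos (by exact_mod_cast hp.pos) v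
  have key : ∀ u : ℤ, ∀ i, (p : ℤ) ^ (2 * v + i) ∣
      normForm ((p : ℤ) ^ v * T) ((p : ℤ) ^ (2 * v) * N) ((p : ℤ) ^ v * u) ↔
        (p : ℤ) ^ i ∣ normForm T N u := by
    intro u i
    rw [mul_comm 2 v, pow_mul, normForm_scale, pow_add, pow_mul]
    exact mul_dvd_mul_iff_left (pow_ne_zero _ hpos.ne')
  have hpow : (p : ℤ) ^ (2 * v + k) = (p : ℤ) ^ v * (p : ℤ) ^ (k + v) := by
    rw [← pow_add]; congr 1; ring
  symm
  refine Finset.card_bij (fun w _ => (p : ℤ) ^ v * w) ?_ ?_ ?_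
  · intro u hu
    simp only [exactLifts, Finset.mem_filter, Finset.mem_Ico] at hu
    simp only [exactResidues, Finset.mem_filter, Finset.mem_Ico, add_assoc, key]
    refine ⟨⟨mul_nonneg hpos.le hu.1.1, ?_⟩, hu.2⟩
    rw [hpow]
    exact mul_lt_mul_of_pos_left hu.1.2 hpos
  · intro a _ b _ hab
    exact mul_left_cancel₀ hpos.ne' hab
  · intro x hx
    simp only [exactResidues, Finset.mem_filter, Finset.mem_Ico] at hx
    by_cases hxv : (p : ℤ) ^ v ∣ x
    · obtain ⟨u, rfl⟩ := hxv
      refine ⟨u, ?_, rfl⟩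
      simp only [exactLifts, Finset.mem_filter, Finset.mem_Ico]
      simp only [add_assoc, key] at hx
      refine ⟨⟨nonneg_of_mul_nonneg_right hx.1.1 hpos, ?_⟩, hx.2⟩
      have := hx.1.2
      rw [hpow] at this
      exact lt_of_mul_lt_mul_left this hpos.le
    · obtain ⟨j, hj, w, rfl, hw⟩ := exists_eq_pow_mul_of_not_pow_dvd hp hxv
      simp only [pow_dvd_normForm_iff hp hj T N hw] at hx
      omega

/-! ### No root modulo `p` -/

theorem card_exactLifts_zero_of_no_root {p : ℕ} {T N : ℤ}
    (h : ∀ u, ¬ (p : ℤ) ∣ normForm T N u) (v : ℕ) : (exactLifts p T N v 0).card = p ^ v := by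
  have e : exactLifts p T N v 0 = Finset.Ico 0 ((p : ℤ) ^ (0 + v)) :=
    Finset.filter_true_of_mem fun u _ => by simpa using h u
  rw [e, zero_add, card_Ico_zero_pow]

theorem exactLifts_eq_empty_of_not_dvd {p : ℕ} {T N : ℤ} {i k : ℕ} (hik : i ≤ k)
    (h : ∀ u, ¬ (p : ℤ) ^ i ∣ normForm T N u) (v : ℕ) : exactLifts p T N v k = ∅ := by
  refine Finset.eq_empty_of_forall_notMem fun u hu => h u ((pow_dvd_pow _ hik).trans ?_)
  rw [exactLifts, Finset.mem_filter] at hu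
  exact hu.2.1

/-! ### A double root modulo `p` -/

/-- Taylor expansion at a: the value and the derivative vanish mod p, leaving (u - a)². -/
theorem dvd_normForm_iff_of_double_root {p : ℕ} (hp : p.Prime) {T N a : ℤ}
    (ha : (p : ℤ) ∣ normForm T N a) (ha' : (p : ℤ) ∣ 2 * a + T) (u : ℤ) :
    (p : ℤ) ∣ normForm T N u ↔ (p : ℤ) ∣ u - a := by
  have hpp : Prime (p : ℤ) := Nat.prime_iff_prime_int.mp hp
  have h : normForm T N u = (u - a) ^ 2 + ((u - a) * (2 * a + T) + normForm T N a) := by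
    unfold normForm; ring
  rw [h, dvd_add_left ((ha'.mul_left _).add ha)]
  exact ⟨hpp.dvd_of_dvd_pow, fun h => dvd_pow h two_ne_zero⟩

theorem card_exactLifts_zero_of_double_root {p : ℕ} (hp : p.Prime) {T N a : ℤ}
    (ha : (p : ℤ) ∣ normForm T N a) (ha' : (p : ℤ) ∣ 2 * a + T) {v : ℕ} (hv : 1 ≤ v) :
    (exactLifts p T N v 0).card = Nat.totient (p ^ v) := by
  rw [← card_Ico_filter_not_dvd_sub hp hv a, exactLifts, zero_add]
  congr 1
  ext u
  simp [dvd_normForm_iff_of_double_root hp ha ha']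

theorem card_exactLifts_one_of_double_root {p : ℕ} (hp : p.Prime) {T N a : ℤ}
    (ha : (p : ℤ) ∣ normForm T N a) (ha' : (p : ℤ) ∣ 2 * a + T)
    (h2 : ∀ u, ¬ (p : ℤ) ^ 2 ∣ normForm T N u) (v : ℕ) :
    (exactLifts p T N v 1).card = p ^ v := by
  have h := card_Ico_filter_dvd_sub hp (Nat.le_add_right 1 v) a
  rw [Nat.add_sub_cancel_left] at h
  rw [← h, exactLifts]
  congr 1
  ext u
  simp [dvd_normForm_iff_of_double_root hp ha ha', h2]

/-! ### A simple root modulo `p` -/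

/-- Hensel's lemma for the monic quadratic, one power of p at a time. -/
theorem exists_lift_of_simple_root {p : ℕ} (hp : p.Prime) {T N a : ℤ}
    (ha : (p : ℤ) ∣ normForm T N a) (ha' : ¬ (p : ℤ) ∣ 2 * a + T) (k : ℕ) :
    ∃ b, (p : ℤ) ^ (k + 1) ∣ normForm T N b ∧ ¬ (p : ℤ) ∣ 2 * b + T := by
  have hpp : Prime (p : ℤ) := Nat.prime_iff_prime_int.mp hp
  induction k with
  | zero => exact ⟨a, by simpa using ha, ha'⟩
  | succ k ih =>
    obtain ⟨b, ⟨c, hc⟩, hb⟩ := ih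
    obtain ⟨s, t, hst⟩ : IsCoprime (2 * b + T) (p : ℤ) :=
      ((Prime.coprime_iff_not_dvd hpp).mpr hb).symm
    -- Newton step: c is the value at b divided by p^(k+1), and s inverts the derivative 2b + T mod
    -- p.
    refine ⟨b - (p : ℤ) ^ (k + 1) * (c * s), ⟨c * t + (p : ℤ) ^ k * (c * s) ^ 2, ?_⟩, ?_⟩
    · have e : normForm T N (b - (p : ℤ) ^ (k + 1) * (c * s)) = normForm T N b -
          (p : ℤ) ^ (k + 1) * (c * (s * (2 * b + T))) + (p : ℤ) ^ (k + 1 + (k + 1)) * (c * s) ^ 2 := by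
        unfold normForm; ring
      rw [e, hc, eq_sub_of_add_eq hst]
      ring
    · have e : 2 * (b - (p : ℤ) ^ (k + 1) * (c * s)) + T =
          (2 * b + T) - p * (2 * (p : ℤ) ^ k * (c * s)) := by ring
      rw [e]
      exact fun h => hb ((dvd_sub_left (dvd_mul_right _ _)).mp h)

/-- Modulo p^k the form factors as (u - a)(u + T + a). The factors differ by 2a + T, which is prime
to p, so all of p^i falls on one of them. -/
theorem pow_dvd_normForm_iff_of_root {p : ℕ} (hp : p.Prime) {T N a : ℤ} {i k : ℕ}
    (ha : (p : ℤ) ^ k ∣ normForm T N a) (ha' : ¬ (p : ℤ) ∣ 2 * a + T) (hik : i ≤ k) (u : ℤ) :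
    (p : ℤ) ^ i ∣ normForm T N u ↔ (p : ℤ) ^ i ∣ u - a ∨ (p : ℤ) ^ i ∣ u - (-T - a) := by
  have hpp : Prime (p : ℤ) := Nat.prime_iff_prime_int.mp hp
  have e : normForm T N u = (u - a) * (u - (-T - a)) + normForm T N a := by
    unfold normForm; ring
  rw [e, dvd_add_left ((pow_dvd_pow _ hik).trans ha)]
  constructor
  · intro h
    by_cases h1 : (p : ℤ) ∣ u - a
    · refine Or.inl (hpp.pow_dvd_of_dvd_mul_right i (fun h2 => ha' ?_) h)
      have h3 := dvd_sub h2 h1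
      have e : u - (-T - a) - (u - a) = 2 * a + T := by ring
      rwa [e] at h3
    · exact Or.inr (hpp.pow_dvd_of_dvd_mul_left i h1 h)
  · rintro (h | h)
    exacts [h.mul_right _, h.mul_left _]

theorem card_filter_root {p : ℕ} (hp : p.Prime) {T N a : ℤ} {i k n : ℕ}
    (ha : (p : ℤ) ^ k ∣ normForm T N a) (ha' : ¬ (p : ℤ) ∣ 2 * a + T) (hi : 1 ≤ i) (hik : i ≤ k)
    (hin : i ≤ n) :
    ((Finset.Ico 0 ((p : ℤ) ^ n)).filter fun u => (p : ℤ) ^ i ∣ normForm T N u).card =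
      2 * p ^ (n - i) := by
  have h : ((Finset.Ico 0 ((p : ℤ) ^ n)).filter fun u => (p : ℤ) ^ i ∣ normForm T N u) =
      ((Finset.Ico 0 ((p : ℤ) ^ n)).filter fun u => (p : ℤ) ^ i ∣ u - a) ∪
      ((Finset.Ico 0 ((p : ℤ) ^ n)).filter fun u => (p : ℤ) ^ i ∣ u - (-T - a)) := by
    rw [← Finset.filter_or]
    exact Finset.filter_congr fun u _ => pow_dvd_normForm_iff_of_root hp ha ha' hik u
  rw [h, Finset.card_union_of_disjoint, card_Ico_filter_dvd_sub hp hin,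
    card_Ico_filter_dvd_sub hp hin, two_mul]
  refine Finset.disjoint_filter.mpr fun u _ h1 h2 => ha' ?_
  have h3 := dvd_sub h2 h1
  have e : u - (-T - a) - (u - a) = 2 * a + T := by ring
  rw [e] at h3
  exact (dvd_pow_self _ (by omega)).trans h3

theorem card_exactLifts_eq_sub {p : ℕ} (T N : ℤ) (v k : ℕ) :
    (exactLifts p T N v k).card =
      ((Finset.Ico 0 ((p : ℤ) ^ (k + v))).filter fun u => (p : ℤ) ^ k ∣ normForm T N u).card -
      ((Finset.Ico 0 ((p : ℤ) ^ (k + v))).filter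
        fun u => (p : ℤ) ^ (k + 1) ∣ normForm T N u).card := by
  rw [← Finset.card_sdiff_of_subset]
  · congr 1
    ext u
    simp only [exactLifts, Finset.mem_filter, Finset.mem_sdiff]
    tauto
  · exact fun u hu => by
      simp only [Finset.mem_filter] at hu ⊢
      exact ⟨hu.1, (pow_dvd_pow _ (Nat.le_succ k)).trans hu.2⟩

theorem card_exactLifts_zero_of_simple_root {p : ℕ} (hp : p.Prime) {T N a : ℤ}
    (ha : (p : ℤ) ∣ normForm T N a) (ha' : ¬ (p : ℤ) ∣ 2 * a + T) {v : ℕ} (hv : 1 ≤ v) :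
    (exactLifts p T N v 0).card = p ^ (v - 1) * (p - 2) := by
  rw [card_exactLifts_eq_sub, card_filter_root (k := 1) hp (by simpa using ha) ha' le_rfl le_rfl
    (by omega), Finset.filter_true_of_mem (by simp), card_Ico_zero_pow]
  obtain ⟨i, rfl⟩ := Nat.exists_eq_add_of_le' hv
  simp only [zero_add, Nat.add_sub_cancel, Nat.mul_sub, pow_succ]
  rw [mul_comm 2]

/-- Lifting the root to precision p^(k+1) allows both divisibilities to be tested against it, and
the count is 2p^v - 2p^(v-1). -/
theorem card_exactLifts_of_simple_root {p : ℕ} (hp : p.Prime) {T N a : ℤ}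
    (ha : (p : ℤ) ∣ normForm T N a) (ha' : ¬ (p : ℤ) ∣ 2 * a + T) {v : ℕ} (hv : 1 ≤ v)
    {k : ℕ} (hk : 1 ≤ k) :
    (exactLifts p T N v k).card = 2 * Nat.totient (p ^ v) := by
  obtain ⟨b, hb, hb'⟩ := exists_lift_of_simple_root hp ha ha' k
  rw [card_exactLifts_eq_sub, card_filter_root hp hb hb' hk (by omega) (by omega),
    card_filter_root hp hb hb' (by omega) (by omega) (by omega)]
  obtain ⟨i, rfl⟩ := Nat.exists_eq_add_of_le' hv
  have e1 : k + (i + 1) - k = i + 1 := by omega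
  have e2 : k + (i + 1) - (k + 1) = i := by omega
  rw [e1, e2, Nat.totient_prime_pow_succ hp, ← Nat.mul_sub, Nat.mul_sub _ p,
    ← pow_succ, mul_one]

/-! ### Lattices p^l(p^m ℤ + (x+θ)ℤ) in a quadratic ring. -/

/-- `1, θ` is a `ℤ`-basis of `R`, and `θ² = T θ - N`. -/
structure QuadBasis {R : Type*} [CommRing R] (θ : R) (T N : ℤ) : Prop where
  repr : ∀ z : R, ∃ a b : ℤ, z = a + b * θ
  indep : ∀ a b : ℤ, (a : R) + b * θ = 0 → a = 0 ∧ b = 0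
  sq : θ ^ 2 = T * θ - N

/-- The ideal `q` is `p^l (p^m ℤ + (x + θ) ℤ)`. -/
def IsLattice {R : Type*} [CommRing R] (θ : R) (p l m : ℕ) (x : ℤ) (q : Ideal R) : Prop :=
  ∀ z, z ∈ q ↔ ∃ s t : ℤ, z = (p : R) ^ l * ((p : R) ^ m * s + (x + θ) * t)

section

variable {R : Type*} [CommRing R] {θ : R} {T N : ℤ} {p l m : ℕ} {x : ℤ} {q : Ideal R}

namespace QuadBasis

theorem ext_iff (B : QuadBasis θ T N) {a b a' b' : ℤ} :
    (a : R) + b * θ = a' + b' * θ ↔ a = a' ∧ b = b' := by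
  constructor
  · intro h
    have h1 := B.indep (a - a') (b - b') (by push_cast; linear_combination h)
    omega
  · rintro ⟨rfl, rfl⟩; rfl

theorem intCast_injective (B : QuadBasis θ T N) {a b : ℤ} (h : (a : R) = b) : a = b := by
  have := (B.ext_iff (a := a) (b := 0) (a' := b) (b' := 0)).mp (by simp [h])
  exact this.1

theorem natCast_ne_zero (B : QuadBasis θ T N) (hp : p.Prime) : (p : R) ≠ 0 := by
  intro h
  have := B.intCast_injective (a := p) (b := 0) (by simpa using h)
  exact hp.ne_zero (by exact_mod_cast this)

theorem mul_conj (B : QuadBasis θ T N) (x : ℤ) :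
    ((x : R) + θ) * (x + T - θ) = (normForm T N x : ℤ) := by
  unfold normForm
  push_cast
  linear_combination -B.sq

theorem mem_iff (B : QuadBasis θ T N) (h : IsLattice θ p l m x q) {a b : ℤ} :
    (a : R) + b * θ ∈ q ↔
      ∃ s t : ℤ, a = (p : ℤ) ^ l * ((p : ℤ) ^ m * s + x * t) ∧ b = (p : ℤ) ^ l * t := by
  rw [h]
  refine exists_congr fun s => exists_congr fun t => ?_
  rw [← B.ext_iff]
  refine Eq.congr_right ?_
  push_cast; ring

theorem exists_isLattice (B : QuadBasis θ T N) (l : ℕ) (h : (p : ℤ) ^ m ∣ normForm T N x) :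
    ∃ q : Ideal R, IsLattice θ p l m x q := by
  obtain ⟨n, hn⟩ := h
  have hn' : (x : R) ^ 2 + T * x + N = p ^ m * n := by
    unfold normForm at hn; exact_mod_cast congrArg (Int.cast (R := R)) hn
  refine ⟨{ carrier := {z | ∃ s t : ℤ, z = (p : R) ^ l * ((p : R) ^ m * s + (x + θ) * t)}
            zero_mem' := ⟨0, 0, by simp⟩
            add_mem' := ?_
            smul_mem' := ?_ }, fun z => Iff.rfl⟩
  · rintro _ _ ⟨s, t, rfl⟩ ⟨s', t', rfl⟩
    exact ⟨s + s', t + t', by push_cast; ring⟩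
  · rintro c _ ⟨s, t, rfl⟩
    obtain ⟨a, b, rfl⟩ := B.repr c
    -- The coefficients come from θ·p^m = p^m(x+θ) - x·p^m and θ(x+θ) = (T+x)(x+θ) - p^m n.
    refine ⟨a * s - b * x * s - b * n * t, a * t + b * p ^ m * s + b * (T + x) * t, ?_⟩
    simp only [smul_eq_mul]
    push_cast
    linear_combination (p : R) ^ l * b * t * B.sq - (p : R) ^ l * b * t * hn'

end QuadBasis

namespace IsLattice

theorem pow_mem (h : IsLattice θ p l m x q) : (p : R) ^ (l + m) ∈ q :=
  (h _).mpr ⟨1, 0, by push_cast; ring⟩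

theorem mul_add_mem (h : IsLattice θ p l m x q) : (p : R) ^ l * (x + θ) ∈ q :=
  (h _).mpr ⟨0, 1, by push_cast; ring⟩

/-- Multiplying p^l(x+θ) by the conjugate x + T - θ puts the integer p^l·N(x+θ) into q, and integers
in q are multiples of p^(l+m). -/
theorem pow_dvd_normForm (h : IsLattice θ p l m x q) (B : QuadBasis θ T N) (hp : p.Prime) :
    (p : ℤ) ^ m ∣ normForm T N x := by
  have h1 := q.mul_mem_right (x + T - θ) h.mul_add_mem
  rw [mul_assoc, B.mul_conj] at h1
  have h2 : (((p : ℤ) ^ l * normForm T N x : ℤ) : R) + (0 : ℤ) * θ ∈ q := by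
    push_cast; simpa using h1
  obtain ⟨s, t, hs, ht⟩ := (B.mem_iff h).mp h2
  have hp0 : (p : ℤ) ^ l ≠ 0 := pow_ne_zero _ (by exact_mod_cast hp.ne_zero)
  obtain rfl : t = 0 := by simpa [hp0] using ht.symm
  exact ⟨s, by simpa using mul_left_cancel₀ hp0 hs⟩

theorem congr {x' : ℤ} (h : IsLattice θ p l m x q) (hx : (p : ℤ) ^ m ∣ x' - x) :
    IsLattice θ p l m x' q := by
  obtain ⟨c, hc⟩ := hx
  have hc' : (x' : R) - x = p ^ m * c := by exact_mod_cast congrArg (Int.cast (R := R)) hc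
  intro z
  rw [h]
  constructor
  · rintro ⟨s, t, rfl⟩
    refine ⟨s - c * t, t, ?_⟩
    push_cast
    linear_combination -(p : R) ^ l * t * hc'
  · rintro ⟨s, t, rfl⟩
    refine ⟨s + c * t, t, ?_⟩
    push_cast
    linear_combination (p : R) ^ l * t * hc'

theorem emod (h : IsLattice θ p l m x q) : IsLattice θ p l m (x % (p : ℤ) ^ m) q :=
  h.congr ((Int.mod_modEq x _).symm.dvd)

theorem eq_of_mem_Ico {x' : ℤ} (h : IsLattice θ p 0 m x q) (h' : IsLattice θ p 0 m x' q)
    (B : QuadBasis θ T N) (hx : x ∈ Set.Ico 0 ((p : ℤ) ^ m)) (hx' : x' ∈ Set.Ico 0 ((p : ℤ) ^ m)) :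
    x = x' := by
  have h1 := h'.mul_add_mem
  have h2 : (x' : R) + (1 : ℤ) * θ ∈ q := by simpa using h1
  obtain ⟨s, t, hs, ht⟩ := (B.mem_iff h).mp h2
  obtain rfl : t = 1 := by simpa using ht.symm
  have h3 : x' % (p : ℤ) ^ m = x % (p : ℤ) ^ m := by
    rw [hs]; simp
  rwa [Int.emod_eq_of_lt hx.1 hx.2, Int.emod_eq_of_lt hx'.1 hx'.2, eq_comm] at h3

theorem ne_top (h : IsLattice θ p l m x q) (B : QuadBasis θ T N) (hp : p.Prime)
    (hlm : 1 ≤ l + m) : q ≠ ⊤ := by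
  rw [Ideal.ne_top_iff_one]
  intro h1
  have h2 : ((1 : ℤ) : R) + (0 : ℤ) * θ ∈ q := by simpa using h1
  obtain ⟨s, t, hs, ht⟩ := (B.mem_iff h).mp h2
  have hp0 : (p : ℤ) ^ l ≠ 0 := pow_ne_zero _ (by exact_mod_cast hp.ne_zero)
  obtain rfl : t = 0 := by simpa [hp0] using ht.symm
  have h3 : (p : ℤ) ∣ 1 := by
    refine (dvd_pow_self (p : ℤ) (n := l + m) (by omega)).trans ⟨s, ?_⟩
    rw [hs]; ring
  exact hp.one_lt.ne' (by exact_mod_cast Int.eq_one_of_dvd_one (by positivity) h3)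

theorem one_le_of_ne_top (h : IsLattice θ p l m x q) (hq : q ≠ ⊤) : 1 ≤ l + m := by
  by_contra hlm
  refine hq ((Ideal.eq_top_iff_one q).mpr ?_)
  have := h.pow_mem
  rwa [show l + m = 0 by omega, pow_zero] at this

theorem ne_bot [IsDomain R] (h : IsLattice θ p l m x q) (B : QuadBasis θ T N) (hp : p.Prime) :
    q ≠ ⊥ := by
  rintro rfl
  exact pow_ne_zero _ (B.natCast_ne_zero hp) ((Ideal.mem_bot).mp h.pow_mem)

/-- The elements a + bθ with 0 ≤ a < p^(l+m) and 0 ≤ b < p^l represent the quotient. -/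
theorem idealNorm_eq (h : IsLattice θ p l m x q) (B : QuadBasis θ T N) (hp : p.Prime) :
    idealNorm q = p ^ (2 * l + m) := by
  have hpl : (0 : ℤ) < (p : ℤ) ^ l := pow_pos (by exact_mod_cast hp.pos) _
  have hplm : (0 : ℤ) < (p : ℤ) ^ (l + m) := pow_pos (by exact_mod_cast hp.pos) _
  let S : Finset (ℤ × ℤ) := Finset.Ico 0 ((p : ℤ) ^ (l + m)) ×ˢ Finset.Ico 0 ((p : ℤ) ^ l)
  have hb : Function.Bijective
      (fun c : S => Ideal.Quotient.mk q ((c.1.1 : R) + (c.1.2 : R) * θ)) := by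
    constructor
    · rintro ⟨⟨a, b⟩, hab⟩ ⟨⟨a', b'⟩, hab'⟩ heq
      simp only [S, Finset.mem_product, Finset.mem_Ico] at hab hab'
      have h1 := Ideal.Quotient.eq.mp heq
      have h2 : ((a - a' : ℤ) : R) + (b - b' : ℤ) * θ ∈ q := by
        convert h1 using 1; push_cast; ring
      obtain ⟨s, t, hs, ht⟩ := (B.mem_iff h).mp h2
      obtain rfl : b = b' := by
        have h3 : b % (p : ℤ) ^ l = b' % (p : ℤ) ^ l := by
          rw [show b = b' + (p : ℤ) ^ l * t by linarith]; simp
        rwa [Int.emod_eq_of_lt hab.2.1 hab.2.2, Int.emod_eq_of_lt hab'.2.1 hab'.2.2] at h3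
      obtain rfl : t = 0 := by simpa [hpl.ne'] using ht.symm
      obtain rfl : a = a' := by
        have h3 : a % (p : ℤ) ^ (l + m) = a' % (p : ℤ) ^ (l + m) := by
          rw [show a = a' + (p : ℤ) ^ (l + m) * s by rw [pow_add]; linear_combination hs]; simp
        rwa [Int.emod_eq_of_lt hab.1.1 hab.1.2, Int.emod_eq_of_lt hab'.1.1 hab'.1.2] at h3
      rfl
    · intro z
      obtain ⟨z, rfl⟩ := Ideal.Quotient.mk_surjective z
      obtain ⟨a, b, rfl⟩ := B.repr z
      -- Reducing b modulo p^l subtracts a multiple of p^l(x+θ), which shifts a before a itself is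
      -- reduced.
      let a' := a - (p : ℤ) ^ l * x * (b / (p : ℤ) ^ l)
      refine ⟨⟨(a' % (p : ℤ) ^ (l + m), b % (p : ℤ) ^ l), ?_⟩, ?_⟩
      · simp only [S, Finset.mem_product, Finset.mem_Ico]
        exact ⟨⟨Int.emod_nonneg _ hplm.ne', Int.emod_lt_of_pos _ hplm⟩,
          ⟨Int.emod_nonneg _ hpl.ne', Int.emod_lt_of_pos _ hpl⟩⟩
      · refine Ideal.Quotient.eq.mpr ?_
        have e : ((a' % (p : ℤ) ^ (l + m) : ℤ) : R) + (b % (p : ℤ) ^ l : ℤ) * θ - (a + b * θ) =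
            ((a' % (p : ℤ) ^ (l + m) - a : ℤ) : R) + (b % (p : ℤ) ^ l - b : ℤ) * θ := by
          push_cast; ring
        rw [e]
        refine (B.mem_iff h).mpr ⟨-(a' / (p : ℤ) ^ (l + m)), -(b / (p : ℤ) ^ l), ?_, ?_⟩
        · have h3 := Int.emod_add_mul_ediv a' ((p : ℤ) ^ (l + m))
          have h4 : a' = a - (p : ℤ) ^ l * x * (b / (p : ℤ) ^ l) := rfl
          rw [pow_add] at h3 ⊢
          linear_combination h3 + h4
        · have h3 := Int.emod_add_mul_ediv b ((p : ℤ) ^ l)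
          linear_combination h3
  have hc := Nat.card_eq_of_bijective _ hb
  rw [idealNorm, ← hc, Nat.card_eq_fintype_card, Fintype.card_coe, Finset.card_product,
    card_Ico_zero_pow, card_Ico_zero_pow, ← pow_add]
  congr 1; ring

end IsLattice

theorem exists_eq_span_pow_of_pow_mem (hp : p.Prime) (I : Ideal ℤ) {k : ℕ}
    (h : (p : ℤ) ^ k ∈ I) : ∃ j, I = Ideal.span {(p : ℤ) ^ j} := by
  obtain ⟨c, rfl⟩ := (IsPrincipalIdealRing.principal I).principal
  rw [Ideal.submodule_span_eq] at h ⊢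
  rw [Ideal.mem_span_singleton] at h
  obtain ⟨j, -, hj⟩ := (dvd_prime_pow (Nat.prime_iff_prime_int.mp hp) k).mp h
  exact ⟨j, Ideal.span_singleton_eq_span_singleton.mpr hj⟩

namespace QuadBasis

/-- Hermite normal form: the θ-coordinates of q form an ideal p^l ℤ, and q ∩ ℤ = p^j ℤ. Both are
generated by powers of p because p^k ∈ q, and m = j - l. -/
theorem exists_isLattice_of_pow_mem (B : QuadBasis θ T N) (hp : p.Prime) {k : ℕ}
    (hk : (p : R) ^ k ∈ q) :
    ∃ (l m : ℕ) (x : ℤ), 0 ≤ x ∧ x < (p : ℤ) ^ m ∧ IsLattice θ p l m x q := by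
  let J : Ideal ℤ :=
    { carrier := {b | ∃ a : ℤ, (a : R) + b * θ ∈ q}
      zero_mem' := ⟨0, by simp⟩
      add_mem' := by
        rintro b b' ⟨a, ha⟩ ⟨a', ha'⟩
        refine ⟨a + a', ?_⟩
        convert q.add_mem ha ha' using 1
        push_cast; ring
      smul_mem' := by
        rintro c b ⟨a, ha⟩
        refine ⟨c * a, ?_⟩
        convert q.mul_mem_left (c : R) ha using 1
        simp only [smul_eq_mul]
        push_cast; ring }
  have hJ : ∀ b : ℤ, b ∈ J ↔ ∃ a : ℤ, (a : R) + b * θ ∈ q := fun b => Iff.rfl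
  obtain ⟨l, hl⟩ := exists_eq_span_pow_of_pow_mem hp J (k := k)
    ((hJ _).mpr ⟨0, by simpa using q.mul_mem_right θ hk⟩)
  obtain ⟨j, hj⟩ := exists_eq_span_pow_of_pow_mem hp (q.comap (Int.castRingHom R)) (k := k)
    (by simpa [Ideal.mem_comap] using hk)
  have hj' : ∀ a : ℤ, (a : R) ∈ q ↔ (p : ℤ) ^ j ∣ a := by
    intro a
    rw [← Ideal.mem_span_singleton, ← hj, Ideal.mem_comap]; rfl
  have hl' : ∀ b : ℤ, (∃ a : ℤ, (a : R) + b * θ ∈ q) ↔ (p : ℤ) ^ l ∣ b := by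
    intro b
    rw [← Ideal.mem_span_singleton, ← hl, hJ]
  have hpl : (0 : ℤ) < (p : ℤ) ^ l := pow_pos (by exact_mod_cast hp.pos) _
  have hlj : l ≤ j := by
    have h1 : (p : ℤ) ^ l ∣ (p : ℤ) ^ j := by
      refine (hl' _).mp ⟨0, ?_⟩
      simpa using q.mul_mem_right θ ((hj' _).mpr (dvd_refl ((p : ℤ) ^ j)))
    exact (Nat.pow_dvd_pow_iff_le_right hp.one_lt).mp (by exact_mod_cast h1)
  obtain ⟨m, rfl⟩ := Nat.exists_eq_add_of_le hlj
  obtain ⟨a₀, ha₀⟩ := (hl' _).mpr (dvd_refl ((p : ℤ) ^ l))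
  -- Multiplying a₀ + p^l θ by θ gives θ-coordinate a₀ + p^l T, which must again lie in p^l ℤ.
  obtain ⟨x, rfl⟩ : (p : ℤ) ^ l ∣ a₀ := by
    have h1 := q.mul_mem_right θ ha₀
    have h2 : ((-((p : ℤ) ^ l * N) : ℤ) : R) + (a₀ + (p : ℤ) ^ l * T : ℤ) * θ ∈ q := by
      convert h1 using 1
      push_cast
      linear_combination -(p : R) ^ l * B.sq
    exact (Int.dvd_add_left (dvd_mul_right _ _)).mp ((hl' _).mp ⟨_, h2⟩)
  have hlat : IsLattice θ p l m x q := by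
    intro z
    constructor
    · intro hz
      obtain ⟨a, b, rfl⟩ := B.repr z
      obtain ⟨t, rfl⟩ := (hl' b).mp ⟨a, hz⟩
      have h1 := q.sub_mem hz (q.mul_mem_left (t : R) ha₀)
      have h2 : ((a - (p : ℤ) ^ l * x * t : ℤ) : R) ∈ q := by
        convert h1 using 1; push_cast; ring
      obtain ⟨s, hs⟩ := (hj' _).mp h2
      have hs' : (a : R) - p ^ l * x * t = p ^ (l + m) * s := by
        exact_mod_cast congrArg (Int.cast (R := R)) hs
      refine ⟨s, t, ?_⟩
      push_cast
      rw [pow_add] at hs'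
      linear_combination hs'
    · rintro ⟨s, t, rfl⟩
      have h1 := q.mul_mem_right (s : R) ((hj' _).mpr (dvd_refl ((p : ℤ) ^ (l + m))))
      have h2 := q.mul_mem_right (t : R) ha₀
      convert q.add_mem h1 h2 using 1
      push_cast; ring
  have hpm : (0 : ℤ) < (p : ℤ) ^ m := pow_pos (by exact_mod_cast hp.pos) _
  exact ⟨l, m, x % (p : ℤ) ^ m, Int.emod_nonneg _ hpm.ne', Int.emod_lt_of_pos _ hpm, hlat.emod⟩

end QuadBasis

end

section

variable {R : Type*} [CommRing R] {θ : R} {T N : ℤ} {p l m : ℕ} {x : ℤ} {q P : Ideal R}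

/-! ### The prime ideal `pℤ + θℤ` -/

theorem IsLattice.mem_prime_iff (h : IsLattice θ p 0 1 0 P) (B : QuadBasis θ T N) {a b : ℤ} :
    (a : R) + b * θ ∈ P ↔ (p : ℤ) ∣ a := by
  rw [B.mem_iff h]
  constructor
  · rintro ⟨s, t, rfl, -⟩
    exact ⟨s, by ring⟩
  · rintro ⟨s, rfl⟩
    exact ⟨s, b, by ring, by ring⟩

theorem IsLattice.isMaximal (h : IsLattice θ p 0 1 0 P) (B : QuadBasis θ T N) (hp : p.Prime) :
    P.IsMaximal := by
  refine Ideal.isMaximal_iff.mpr ⟨(Ideal.ne_top_iff_one P).mp (h.ne_top B hp le_rfl), ?_⟩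
  intro J z hJ hz hzJ
  obtain ⟨a, b, rfl⟩ := B.repr z
  rw [h.mem_prime_iff B] at hz
  obtain ⟨s, t, hst⟩ := (Prime.coprime_iff_not_dvd (Nat.prime_iff_prime_int.mp hp)).mpr hz
  have h1 : ((p * s : ℤ) : R) + (-(t * b) : ℤ) * θ ∈ P :=
    (h.mem_prime_iff B).mpr (dvd_mul_right _ _)
  have h2 := J.add_mem (hJ h1) (J.mul_mem_left (t : R) hzJ)
  have h3 : (s : R) * p + t * a = 1 := by exact_mod_cast congrArg (Int.cast (R := R)) hst
  convert h2 using 1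
  push_cast
  linear_combination -h3

/-- By maximality of P, it suffices that P lies in the radical of q. That radical contains p, hence
θ² = Tθ - N, hence θ. -/
theorem IsLattice.radical_eq_iff (h : IsLattice θ p 0 1 0 P) (B : QuadBasis θ T N) (hp : p.Prime)
    (hT : (p : ℤ) ∣ T) (hN : (p : ℤ) ∣ N) :
    q.radical = P ↔ (∃ k : ℕ, (p : R) ^ k ∈ q) ∧ q ≠ ⊤ := by
  constructor
  · rintro rfl
    refine ⟨?_, fun hq => (h.isMaximal B hp).ne_top (by rw [hq, Ideal.radical_top])⟩
    have := h.pow_mem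
    rw [zero_add, pow_one] at this
    exact this
  · rintro ⟨hk, hq⟩
    symm
    refine (h.isMaximal B hp).eq_of_le (fun ht => hq (Ideal.radical_eq_top.mp ht)) ?_
    have hpr : (p : R) ∈ q.radical := hk
    have hdvd : ∀ {a : ℤ}, (p : ℤ) ∣ a → (a : R) ∈ q.radical := by
      rintro _ ⟨c, rfl⟩
      push_cast
      exact q.radical.mul_mem_right _ hpr
    have hθ : θ ∈ q.radical := by
      rw [← Ideal.radical_idem]
      refine ⟨2, ?_⟩
      rw [B.sq]
      exact q.radical.sub_mem (q.radical.mul_mem_right _ (hdvd hT)) (hdvd hN)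
    intro z hz
    obtain ⟨a, b, rfl⟩ := B.repr z
    exact q.radical.add_mem (hdvd ((h.mem_prime_iff B).mp hz)) (q.radical.mul_mem_left _ hθ)

theorem IsLattice.isPrimary_of_radical_eq (h : IsLattice θ p 0 1 0 P) (B : QuadBasis θ T N)
    (hp : p.Prime) (hq : q.radical = P) : q.IsPrimary :=
  Ideal.isPrimary_of_isMaximal_radical (hq ▸ h.isMaximal B hp)

/-! ### Invertibility -/

theorem invertible_of_mul_eq_span [IsDomain R] {I J : Ideal R} {c : R} (hc : c ≠ 0)
    (h : I * J = Ideal.span {c}) : Invertible I := by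
  have h1 : (I : FractionalIdeal R⁰ (FractionRing R)) * J =
      FractionalIdeal.spanSingleton R⁰ (algebraMap R (FractionRing R) c) := by
    rw [← FractionalIdeal.coeIdeal_mul, h, FractionalIdeal.coeIdeal_span_singleton]
  have hc' : algebraMap R (FractionRing R) c ≠ 0 := by simpa using hc
  have h2 : IsUnit ((I : FractionalIdeal R⁰ (FractionRing R)) * J) := by
    rw [h1]
    refine IsUnit.of_mul_eq_one
      (FractionalIdeal.spanSingleton R⁰ (algebraMap R (FractionRing R) c)⁻¹) ?_
    rw [FractionalIdeal.spanSingleton_mul_spanSingleton, mul_inv_cancel₀ hc',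
      FractionalIdeal.spanSingleton_one]
  exact isUnit_of_mul_isUnit_left h2

theorem Invertible.le_of_mul_le_mul [IsDomain R] {I J J' : Ideal R} (h : Invertible I)
    (hle : J * I ≤ J' * I) : J ≤ J' := by
  obtain ⟨u, hu⟩ := h
  rw [← FractionalIdeal.coeIdeal_le_coeIdeal (FractionRing R), FractionalIdeal.coeIdeal_mul,
    FractionalIdeal.coeIdeal_mul, ← hu] at hle
  rw [← FractionalIdeal.coeIdeal_le_coeIdeal (FractionRing R)]
  have h1 := mul_le_mul_left hle (u⁻¹ : (FractionalIdeal R⁰ (FractionRing R))ˣ).val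
  simpa [mul_assoc] using h1

/-- Modulo p the form is x², so p ∣ x. -/
theorem dvd_two_mul_add_of_dvd_normForm (hp : p.Prime) (hT : (p : ℤ) ∣ T) (hN : (p : ℤ) ∣ N)
    (h : (p : ℤ) ∣ normForm T N x) : (p : ℤ) ∣ 2 * x + T := by
  have h1 : (p : ℤ) ∣ x ^ 2 := by
    have e : x ^ 2 = normForm T N x - (T * x + N) := by unfold normForm; ring
    rw [e]
    exact dvd_sub h ((hT.mul_right _).add hN)
  exact (((Nat.prime_iff_prime_int.mp hp).dvd_of_dvd_pow h1).mul_left 2).add hT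

/-- The product with the conjugate contains p^(2l)·p^m·p^m and p^(2l)·p^m·n up to sign, where n is
prime to p. Bézout then yields the generator. -/
theorem IsLattice.mul_conj_eq (h : IsLattice θ p l m x q) (B : QuadBasis θ T N) (hp : p.Prime)
    (hn : ¬ (p : ℤ) ^ (m + 1) ∣ normForm T N x) :
    ∃ q' : Ideal R, q * q' = Ideal.span {(p : R) ^ (2 * l + m)} := by
  obtain ⟨n, hxn⟩ := h.pow_dvd_normForm B hp
  -- Since (-x - T) + θ = -(x + T - θ), the lattice at -x - T is the conjugate of q.
  have e : normForm T N (-x - T) = normForm T N x := by unfold normForm; ring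
  obtain ⟨q', h'⟩ := B.exists_isLattice l (e ▸ h.pow_dvd_normForm B hp)
  have hmul : ((x : R) + θ) * ((-x - T : ℤ) + θ) = -(p ^ m * n) := by
    have h1 := B.mul_conj x
    rw [hxn] at h1
    push_cast at h1 ⊢
    linear_combination -h1
  have hpn : ¬ (p : ℤ) ∣ n := fun hd => hn (by rw [hxn, pow_succ]; exact mul_dvd_mul_left _ hd)
  obtain ⟨u, w, huw⟩ := (IsCoprime.pow_left
    ((Prime.coprime_iff_not_dvd (Nat.prime_iff_prime_int.mp hp)).mpr hpn) : IsCoprime ((p : ℤ) ^ m) n)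
  have huw' : (u : R) * p ^ m + w * n = 1 := by exact_mod_cast congrArg (Int.cast (R := R)) huw
  refine ⟨q', le_antisymm (Ideal.mul_le.mpr ?_) ?_⟩
  · intro y hy y' hy'
    obtain ⟨s, t, rfl⟩ := (h y).mp hy
    obtain ⟨s', t', rfl⟩ := (h' y').mp hy'
    refine Ideal.mem_span_singleton.mpr ⟨p ^ m * s * s' + s * ((-x - T : ℤ) + θ) * t' +
      s' * (x + θ) * t - n * t * t', ?_⟩
    rw [pow_add, two_mul, pow_add]
    linear_combination (p : R) ^ l * p ^ l * t * t' * hmul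
  · rw [Ideal.span_singleton_le_iff_mem]
    have h1 := (q * q').mul_mem_left (u : R) (Ideal.mul_mem_mul h.pow_mem h'.pow_mem)
    have h2 := (q * q').mul_mem_left (w : R) (Ideal.mul_mem_mul h.mul_add_mem h'.mul_add_mem)
    convert (q * q').sub_mem h1 h2 using 1
    rw [pow_add, pow_add, two_mul, pow_add]
    linear_combination (p : R) ^ l * p ^ l * w * hmul - (p : R) ^ l * p ^ l * p ^ m * huw'

theorem IsLattice.eq_span_of_zero (h : IsLattice θ p l 0 x q) (B : QuadBasis θ T N) :
    q = Ideal.span {(p : R) ^ l} := by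
  ext z
  rw [h, Ideal.mem_span_singleton]
  constructor
  · rintro ⟨s, t, rfl⟩
    exact dvd_mul_right _ _
  · rintro ⟨c, rfl⟩
    obtain ⟨a, b, rfl⟩ := B.repr c
    exact ⟨a - x * b, b, by push_cast; ring⟩

/-- The conjugate x + T - θ = (2x+T) - (x+θ) maps q into pq, because p divides 2x + T and p^(m+2)
divides the norm. Cancelling q would put it in pR, but its θ-coordinate is -1. -/
theorem IsLattice.not_invertible [IsDomain R] (h : IsLattice θ p l (m + 1) x q)
    (B : QuadBasis θ T N) (hp : p.Prime) (hT : (p : ℤ) ∣ T) (hN : (p : ℤ) ∣ N)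
    (hn : (p : ℤ) ^ (m + 2) ∣ normForm T N x) : ¬ Invertible q := by
  obtain ⟨n, hn⟩ := hn
  obtain ⟨c, hc⟩ := dvd_two_mul_add_of_dvd_normForm hp hT hN
    (x := x) (hn ▸ (dvd_pow_self _ (by omega)).mul_right n)
  have hc' : (2 * x + T : R) = p * c := by exact_mod_cast congrArg (Int.cast (R := R)) hc
  have hmul := B.mul_conj x
  rw [hn] at hmul
  push_cast at hmul
  intro hinv
  have hle : Ideal.span {(x + T - θ : R)} ≤ Ideal.span {(p : R)} := by
    refine hinv.le_of_mul_le_mul (Ideal.mul_le.mpr ?_)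
    intro y hy z hz
    obtain ⟨y, rfl⟩ := Ideal.mem_span_singleton.mp hy
    obtain ⟨s, t, rfl⟩ := (h z).mp hz
    have h1 : (p : R) ^ l * (p ^ (m + 1) * (s * c + n * t : ℤ) + (x + θ) * (-(p ^ m * s) : ℤ)) ∈ q :=
      (h _).mpr ⟨_, _, rfl⟩
    have h2 := Ideal.mul_mem_left _ y (Ideal.mul_mem_mul (Ideal.mem_span_singleton_self (p : R)) h1)
    convert h2 using 1
    push_cast
    linear_combination (y * p ^ l * p ^ (m + 1) * s : R) * hc' + (y * p ^ l * t : R) * hmul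
  rw [Ideal.span_singleton_le_span_singleton] at hle
  obtain ⟨z, hz⟩ := hle
  obtain ⟨a, b, rfl⟩ := B.repr z
  have h3 : ((x + T : ℤ) : R) + (-1 : ℤ) * θ = (p * a : ℤ) + (p * b : ℤ) * θ := by
    push_cast; linear_combination hz
  have h4 : (p : ℤ) ∣ 1 := ⟨-b, by linarith [(B.ext_iff.mp h3).2]⟩
  exact hp.one_lt.ne' (by exact_mod_cast Int.eq_one_of_dvd_one (by positivity) h4)

theorem IsLattice.invertible_iff [IsDomain R] (h : IsLattice θ p l m x q) (B : QuadBasis θ T N)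
    (hp : p.Prime) (hT : (p : ℤ) ∣ T) (hN : (p : ℤ) ∣ N) :
    Invertible q ↔ m = 0 ∨ ¬ (p : ℤ) ^ (m + 1) ∣ normForm T N x := by
  have hp0 := B.natCast_ne_zero hp
  constructor
  · intro hinv
    rcases m with _ | m
    · exact Or.inl rfl
    · exact Or.inr fun hn => h.not_invertible B hp hT hN hn hinv
  · rintro (rfl | hn)
    · refine invertible_of_mul_eq_span (J := ⊤) (pow_ne_zero l hp0) ?_
      rw [Ideal.mul_top, h.eq_span_of_zero B]
    · obtain ⟨q', hq'⟩ := h.mul_conj_eq B hp hn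
      exact invertible_of_mul_eq_span (pow_ne_zero _ hp0) hq'

/-! ### Ideal atoms -/

theorem IsLattice.coords_of_mem_mul_self (h : IsLattice θ p 0 1 0 P) (B : QuadBasis θ T N)
    (hT : (p : ℤ) ∣ T) (hN : (p : ℤ) ^ 2 ∣ N) {a b : ℤ} (hab : (a : R) + b * θ ∈ P * P) :
    (p : ℤ) ^ 2 ∣ a ∧ (p : ℤ) ∣ b := by
  have h0 : (p : ℤ) ^ 1 ∣ normForm T N 0 := by
    rw [pow_one]
    simpa [normForm] using (dvd_pow_self _ two_ne_zero).trans hN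
  -- Here r = p(pℤ + θℤ) = pP. It contains P² since p ∣ T and p² ∣ N.
  obtain ⟨r, hr⟩ := B.exists_isLattice 1 h0
  obtain ⟨T', rfl⟩ := hT
  obtain ⟨N', rfl⟩ := hN
  have hle : P * P ≤ r := by
    refine Ideal.mul_le.mpr fun y hy z hz => ?_
    obtain ⟨s, t, rfl⟩ := (h y).mp hy
    obtain ⟨s', t', rfl⟩ := (h z).mp hz
    refine (hr _).mpr ⟨s * s' - N' * t * t', s * t' + s' * t + T' * t * t', ?_⟩
    have h2 := B.sq
    push_cast at h2 ⊢
    linear_combination (t * t' : R) * h2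
  obtain ⟨s, t, rfl, rfl⟩ := (B.mem_iff hr).mp (hle hab)
  exact ⟨⟨s, by ring⟩, ⟨t, by ring⟩⟩

/-- Any factor of q contains a power of p, so a proper one lies in P. Two proper factors would force
q ⊆ P². -/
theorem IsLattice.isIdealAtom_of_notMem [IsDomain R] (hP : IsLattice θ p 0 1 0 P)
    (h : IsLattice θ p l m x q) (B : QuadBasis θ T N) (hp : p.Prime) (hT : (p : ℤ) ∣ T)
    (hN : (p : ℤ) ∣ N) (hlm : 1 ≤ l + m) (hq : ¬ q ≤ P * P) : IsIdealAtom q := by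
  refine ⟨h.ne_bot B hp, ?_, ?_⟩
  · rw [Ideal.isUnit_iff]
    exact h.ne_top B hp hlm
  · rintro I J rfl
    rw [Ideal.isUnit_iff, Ideal.isUnit_iff]
    by_contra hIJ
    push Not at hIJ
    have hle : ∀ {I' : Ideal R}, I * J ≤ I' → I' ≠ ⊤ → I' ≤ P := fun {I'} h1 h2 =>
      ((hP.radical_eq_iff B hp hT hN).mpr ⟨⟨_, h1 h.pow_mem⟩, h2⟩) ▸ Ideal.le_radical
    exact hq (Ideal.mul_mono (hle Ideal.mul_le_left hIJ.1) (hle Ideal.mul_le_right hIJ.2))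

theorem IsLattice.isIdealAtom [IsDomain R] (hP : IsLattice θ p 0 1 0 P)
    (h : IsLattice θ p 0 m x q) (B : QuadBasis θ T N) (hp : p.Prime) (hT : (p : ℤ) ∣ T)
    (hN : (p : ℤ) ^ 2 ∣ N) (hm : 1 ≤ m) : IsIdealAtom q := by
  refine hP.isIdealAtom_of_notMem h B hp hT ((dvd_pow_self _ two_ne_zero).trans hN) (by omega) ?_
  intro hle
  have h1 : (x : R) + (1 : ℤ) * θ ∈ P * P := hle (by simpa using h.mul_add_mem)
  have h2 := (hP.coords_of_mem_mul_self B hT hN h1).2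
  exact hp.one_lt.ne' (by exact_mod_cast Int.eq_one_of_dvd_one (by positivity) h2)

theorem QuadBasis.isLattice_span (B : QuadBasis θ T N) (p : ℕ) :
    IsLattice θ p 1 0 0 (Ideal.span {(p : R)}) := by
  obtain ⟨q, h⟩ := B.exists_isLattice (p := p) (m := 0) (x := 0) 1 (by simp)
  have := h.eq_span_of_zero B
  rw [pow_one] at this
  exact this ▸ h

theorem IsLattice.isIdealAtom_span [IsDomain R] (hP : IsLattice θ p 0 1 0 P)
    (B : QuadBasis θ T N) (hp : p.Prime) (hT : (p : ℤ) ∣ T)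
    (hN : (p : ℤ) ^ 2 ∣ N) : IsIdealAtom (Ideal.span {(p : R)}) := by
  refine hP.isIdealAtom_of_notMem (B.isLattice_span p) B hp hT
    ((dvd_pow_self _ two_ne_zero).trans hN) le_rfl ?_
  intro hle
  have h1 : ((p : ℤ) : R) + (0 : ℤ) * θ ∈ P * P :=
    hle (by simp)
  have h2 := (hP.coords_of_mem_mul_self B hT hN h1).1
  have h3 : p ^ 2 ∣ p ^ 1 := by rw [pow_one]; exact_mod_cast h2
  exact absurd ((Nat.pow_dvd_pow_iff_le_right hp.one_lt).mp h3) (by norm_num)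

/-- If l ≥ 1, then q is pR times the lattice with l lowered by one, which must then be the unit
ideal. -/
theorem IsLattice.eq_span_or_zero_of_isIdealAtom [IsDomain R] (h : IsLattice θ p l m x q)
    (B : QuadBasis θ T N) (hp : p.Prime) (hq : IsIdealAtom q) :
    q = Ideal.span {(p : R)} ∨ l = 0 := by
  rcases l with _ | l
  · exact Or.inr rfl
  left
  obtain ⟨q', h'⟩ := B.exists_isLattice l (h.pow_dvd_normForm B hp)
  have e : q = Ideal.span {(p : R)} * q' := by
    ext z
    rw [Ideal.mem_span_singleton_mul, h]
    constructor
    · rintro ⟨s, t, rfl⟩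
      exact ⟨_, (h' _).mpr ⟨s, t, rfl⟩, by ring⟩
    · rintro ⟨y, hy, rfl⟩
      obtain ⟨s, t, rfl⟩ := (h' y).mp hy
      exact ⟨s, t, by ring⟩
  rcases hq.2.isUnit_or_isUnit e with hu | hu
  · exact absurd (Ideal.isUnit_iff.mp hu) ((B.isLattice_span p).ne_top B hp le_rfl)
  · rw [e, Ideal.isUnit_iff.mp hu, Ideal.mul_top]

/-! ### Counting the invertible atoms -/

theorem IsLattice.encard_invertible_atoms [IsDomain R] (hP : IsLattice θ p 0 1 0 P)
    (B : QuadBasis θ T N) (hp : p.Prime) (hT : (p : ℤ) ∣ T) (hN : (p : ℤ) ^ 2 ∣ N) (hm : 1 ≤ m) :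
    {I : Ideal R | IsIdealAtom I ∧ Invertible I ∧ idealNorm I = p ^ m ∧
      ∃ x : ℤ, IsLattice θ p 0 m x I}.encard = (exactResidues p T N m).card := by
  have hN1 := (dvd_pow_self _ two_ne_zero).trans hN
  have hex : ∀ x ∈ exactResidues p T N m, ∃ I : Ideal R, IsLattice θ p 0 m x I := fun x hx =>
    B.exists_isLattice 0 (Finset.mem_filter.mp hx).2.1
  choose! g hg using hex
  have hinj : Set.InjOn g (exactResidues p T N m : Set ℤ) := by
    intro x hx x' hx' hxx'
    have h1 := hg x hx
    have h2 := hg x' hx'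
    rw [← hxx'] at h2
    exact h1.eq_of_mem_Ico h2 B (by simpa using (Finset.mem_filter.mp hx).1)
      (by simpa using (Finset.mem_filter.mp hx').1)
  have himg : {I : Ideal R | IsIdealAtom I ∧ Invertible I ∧ idealNorm I = p ^ m ∧
      ∃ x : ℤ, IsLattice θ p 0 m x I} = g '' (exactResidues p T N m : Set ℤ) := by
    ext I
    constructor
    · rintro ⟨-, hinv, -, x, hx⟩
      have hpm : (0 : ℤ) < (p : ℤ) ^ m := pow_pos (by exact_mod_cast hp.pos) _
      have hx' := hx.emod
      have hmem : x % (p : ℤ) ^ m ∈ exactResidues p T N m := by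
        refine Finset.mem_filter.mpr ⟨Finset.mem_Ico.mpr
          ⟨Int.emod_nonneg _ hpm.ne', Int.emod_lt_of_pos _ hpm⟩, hx'.pow_dvd_normForm B hp, ?_⟩
        exact ((hx'.invertible_iff B hp hT hN1).mp hinv).resolve_left (by omega)
      refine ⟨_, hmem, ?_⟩
      ext z
      rw [hg _ hmem, hx']
    · rintro ⟨x, hx, rfl⟩
      have h := hg x hx
      refine ⟨hP.isIdealAtom h B hp hT hN hm, ?_, ?_, x, h⟩
      · exact (h.invertible_iff B hp hT hN1).mpr (Or.inr (Finset.mem_filter.mp hx).2.2)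
      · rw [h.idealNorm_eq B hp, mul_zero, zero_add]
  rw [himg, hinj.encard_image, Set.encard_coe_eq_coe_finsetCard]

end

section

variable {R : Type*} [CommRing R] {θ : R} {T N : ℤ} {p : ℕ} {g : ℤ}

/-! ### The decomposition of `p` and the roots modulo `p` of the norm form -/

namespace QuadBasis

theorem mem_span_iff (B : QuadBasis θ T N) {a b : ℤ} :
    (a : R) + b * θ ∈ Ideal.span {(p : R)} ↔ (p : ℤ) ∣ a ∧ (p : ℤ) ∣ b := by
  rw [Ideal.mem_span_singleton]
  constructor
  · rintro ⟨z, hz⟩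
    obtain ⟨c, e, rfl⟩ := B.repr z
    have h : (a : R) + b * θ = (p * c : ℤ) + (p * e : ℤ) * θ := by
      push_cast; linear_combination hz
    obtain ⟨rfl, rfl⟩ := B.ext_iff.mp h
    exact ⟨dvd_mul_right _ _, dvd_mul_right _ _⟩
  · rintro ⟨⟨c, rfl⟩, e, rfl⟩
    exact ⟨c + e * θ, by push_cast; ring⟩

theorem intCast_mem_span_iff (B : QuadBasis θ T N) {a : ℤ} :
    (a : R) ∈ Ideal.span {(p : R)} ↔ (p : ℤ) ∣ a := by
  have := B.mem_span_iff (p := p) (a := a) (b := 0)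
  simpa using this

theorem scaled_mul_conj (B : QuadBasis θ T N) (u g : ℤ) :
    ((u : R) + g * θ) * ((u + g * T : ℤ) + (-g : ℤ) * θ) =
      (normForm (g * T) (g ^ 2 * N) u : ℤ) := by
  unfold normForm
  push_cast
  linear_combination -(g : R) ^ 2 * B.sq

/-- A root u puts u + gθ or its conjugate into the prime (p), although their θ-coordinates ±g are
prime to p. -/
theorem not_dvd_normForm_of_isPrime (B : QuadBasis θ T N) (hg : ¬ (p : ℤ) ∣ g)
    (h : (Ideal.span {(p : R)}).IsPrime) (u : ℤ) :
    ¬ (p : ℤ) ∣ normForm (g * T) (g ^ 2 * N) u := by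
  intro hu
  rw [← B.intCast_mem_span_iff, ← B.scaled_mul_conj] at hu
  rcases h.mem_or_mem hu with h1 | h1
  · exact hg (B.mem_span_iff.mp h1).2
  · exact hg ((dvd_neg).mp (B.mem_span_iff.mp h1).2)

theorem mem_span_of_dvd_norm (B : QuadBasis θ T N) (hp : p.Prime)
    (h : ∀ u, ¬ (p : ℤ) ∣ normForm (g * T) (g ^ 2 * N) u) {a b : ℤ}
    (hab : (p : ℤ) ∣ normForm (b * T) (b ^ 2 * N) a) :
    (a : R) + b * θ ∈ Ideal.span {(p : R)} := by
  have hpp := Nat.prime_iff_prime_int.mp hp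
  rw [B.mem_span_iff]
  by_cases hb : (p : ℤ) ∣ b
  · refine ⟨?_, hb⟩
    have e : a ^ 2 = normForm (b * T) (b ^ 2 * N) a - b * (T * a + b * N) := by
      unfold normForm; ring
    exact hpp.dvd_of_dvd_pow (e ▸ dvd_sub hab (hb.mul_right _))
  · exfalso
    obtain ⟨r, s, hrs⟩ := (Prime.coprime_iff_not_dvd hpp).mpr hb
    -- As s inverts b mod p, scaling a + bθ by gs makes its θ-coordinate congruent to g, while the
    -- norm stays divisible by p.
    refine h (a * g * s) ?_
    have e : normForm (g * T) (g ^ 2 * N) (a * g * s) = g ^ 2 * s ^ 2 *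
        normForm (b * T) (b ^ 2 * N) a +
        p * (r * (g ^ 2 * T * a * s + g ^ 2 * N * (1 + s * b))) := by
      unfold normForm
      linear_combination (-g ^ 2 * T * a * s - g ^ 2 * N * (1 + s * b)) * hrs
    rw [e]
    exact (hab.mul_left _).add (dvd_mul_right _ _)

theorem isPrime_span_of_not_dvd (B : QuadBasis θ T N) (hp : p.Prime)
    (h : ∀ u, ¬ (p : ℤ) ∣ normForm (g * T) (g ^ 2 * N) u) :
    (Ideal.span {(p : R)}).IsPrime := by
  refine Ideal.isPrime_iff.mpr ⟨(B.isLattice_span p).ne_top B hp le_rfl, ?_⟩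
  intro y z hyz
  obtain ⟨a, b, rfl⟩ := B.repr y
  obtain ⟨c, e, rfl⟩ := B.repr z
  have h1 := Ideal.mul_mem_right (((a + b * T : ℤ) + (-b : ℤ) * θ) *
    ((c + e * T : ℤ) + (-e : ℤ) * θ)) _ hyz
  rw [mul_mul_mul_comm, B.scaled_mul_conj, B.scaled_mul_conj, ← Int.cast_mul,
    B.intCast_mem_span_iff] at h1
  exact ((Nat.prime_iff_prime_int.mp hp).dvd_or_dvd h1).imp
    (B.mem_span_of_dvd_norm hp h) (B.mem_span_of_dvd_norm hp h)

theorem exists_root_of_mem (B : QuadBasis θ T N) (hp : p.Prime) {P : Ideal R} (hP : P.IsPrime)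
    (hpP : (p : R) ∈ P) (hn : ¬ (Ideal.span {(p : R)}).IsPrime) :
    ∃ u : ℤ, (p : ℤ) ∣ normForm (g * T) (g ^ 2 * N) u ∧ (u : R) + g * θ ∈ P := by
  have h := mt (B.isPrime_span_of_not_dvd hp (g := g)) hn
  push Not at h
  obtain ⟨u, hu⟩ := h
  have h1 : ((normForm (g * T) (g ^ 2 * N) u : ℤ) : R) ∈ P :=
    (Ideal.span_singleton_le_iff_mem P).mpr hpP (B.intCast_mem_span_iff.mpr hu)
  rw [← B.scaled_mul_conj] at h1
  rcases hP.mem_or_mem h1 with h2 | h2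
  · exact ⟨u, hu, h2⟩
  · refine ⟨-u - g * T, ?_, ?_⟩
    · convert hu using 1
      unfold normForm; ring
    · convert P.neg_mem h2 using 1
      push_cast; ring

theorem dvd_two_mul_add_of_sq (B : QuadBasis θ T N) (hp : p.Prime) (hg : ¬ (p : ℤ) ∣ g)
    {u : ℤ} (h : ((u : R) + g * θ) ^ 2 ∈ Ideal.span {(p : R)}) : (p : ℤ) ∣ 2 * u + g * T := by
  have e : ((u : R) + g * θ) ^ 2 = (u ^ 2 - g ^ 2 * N : ℤ) + ((2 * u + g * T) * g : ℤ) * θ := by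
    push_cast
    linear_combination (g : R) ^ 2 * B.sq
  rw [e, B.mem_span_iff] at h
  exact ((Nat.prime_iff_prime_int.mp hp).dvd_or_dvd h.2).resolve_right hg

end QuadBasis

/-- Modulo P, g(a + bθ) is the integer ga - bu, and P ∩ ℤ = pℤ. So P is determined by the residue of
u mod p. -/
theorem mem_prime_iff_of_root_mem (hp : p.Prime) (hg : ¬ (p : ℤ) ∣ g)
    {P : Ideal R} (hP : P.IsPrime) (hpP : (p : R) ∈ P) {u : ℤ} (hu : (u : R) + g * θ ∈ P)
    {a b : ℤ} : (a : R) + b * θ ∈ P ↔ (p : ℤ) ∣ g * a - b * u := by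
  have hint : ∀ c : ℤ, (c : R) ∈ P ↔ (p : ℤ) ∣ c := by
    intro c
    constructor
    · intro hc
      by_contra hpc
      obtain ⟨r, s, hrs⟩ := (Prime.coprime_iff_not_dvd (Nat.prime_iff_prime_int.mp hp)).mpr hpc
      have h2 : (r : R) * p + s * c = 1 := by exact_mod_cast congrArg (Int.cast (R := R)) hrs
      refine hP.ne_top ((Ideal.eq_top_iff_one P).mpr ?_)
      rw [← h2]
      exact P.add_mem (P.mul_mem_left _ hpP) (P.mul_mem_left _ hc)
    · rintro ⟨c, rfl⟩
      push_cast
      exact P.mul_mem_right _ hpP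
  have h1 : (g : R) * (a + b * θ) = (g * a - b * u : ℤ) + b * (u + g * θ) := by
    push_cast; ring
  rw [← hint, ← P.add_mem_iff_left (a := ((g * a - b * u : ℤ) : R)) (P.mul_mem_left (b : R) hu),
    ← h1]
  exact ⟨P.mul_mem_left _, fun h => (hP.mem_or_mem h).resolve_left (mt (hint g).mp hg)⟩

end

/-! ### Decomposition of p in the ring of integers. -/

section NumberField

variable {K : Type*} [Field K] [NumberField K] {θ : NumberField.RingOfIntegers K} {T N : ℤ}
  {p : ℕ} {g : ℤ}

theorem not_isPrime_of_eq_mul (hp : p.Prime) {P Q : Ideal (NumberField.RingOfIntegers K)}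
    (hP : P.IsPrime) (hQ : Q.IsPrime) (h : extended K p = P * Q) :
    ¬ (extended K p).IsPrime := by
  have hne : P * Q ≠ ⊥ := by
    rw [← h, extended, Ne, Ideal.span_singleton_eq_bot]
    exact_mod_cast hp.ne_zero
  have hP0 : P ≠ 0 := fun h0 => hne (by rw [h0, zero_mul]; rfl)
  have hQ0 : Q ≠ 0 := fun h0 => hne (by rw [h0, mul_zero]; rfl)
  rw [h]
  intro hPQ
  rcases (Ideal.IsPrime.mul_le hPQ).mp le_rfl with hle | hle
  · refine hQ.ne_top (mul_left_cancel₀ hP0 ?_)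
    rw [Ideal.mul_top]
    exact le_antisymm Ideal.mul_le_left hle
  · refine hP.ne_top (mul_right_cancel₀ hQ0 ?_)
    rw [Ideal.top_mul]
    exact le_antisymm Ideal.mul_le_right hle

theorem Ramified.exists_double_root (h : Ramified K p) (B : QuadBasis θ T N) (hp : p.Prime)
    (hg : ¬ (p : ℤ) ∣ g) :
    ∃ u : ℤ, (p : ℤ) ∣ normForm (g * T) (g ^ 2 * N) u ∧ (p : ℤ) ∣ 2 * u + g * T := by
  obtain ⟨P, hP, hPP⟩ := h
  have hn := not_isPrime_of_eq_mul hp hP hP (hPP.trans (sq P))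
  have hpP : (p : NumberField.RingOfIntegers K) ∈ P :=
    Ideal.pow_le_self two_ne_zero (hPP ▸ Ideal.mem_span_singleton_self _)
  obtain ⟨u, hu, hmem⟩ := B.exists_root_of_mem hp hP hpP hn (g := g)
  exact ⟨u, hu, B.dvd_two_mul_add_of_sq hp hg (hPP ▸ Ideal.pow_mem_pow hmem 2 :)⟩

/-- Each of the two primes yields a root. If the root were double, both would be congruent mod p,
and the primes would coincide. -/
theorem Splits.exists_simple_root (h : Splits K p) (B : QuadBasis θ T N) (hp : p.Prime)
    (hg : ¬ (p : ℤ) ∣ g) :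
    ∃ u : ℤ, (p : ℤ) ∣ normForm (g * T) (g ^ 2 * N) u ∧ ¬ (p : ℤ) ∣ 2 * u + g * T := by
  obtain ⟨P, Q, hP, hQ, hne, hPQ⟩ := h
  have hn := not_isPrime_of_eq_mul hp hP hQ hPQ
  have hmem : (p : NumberField.RingOfIntegers K) ∈ P * Q :=
    hPQ ▸ Ideal.mem_span_singleton_self _
  have hpP := Ideal.mul_le_left hmem
  have hpQ := Ideal.mul_le_right hmem
  obtain ⟨u, hu, huP⟩ := B.exists_root_of_mem hp hP hpP hn (g := g)
  obtain ⟨w, hw, hwQ⟩ := B.exists_root_of_mem hp hQ hpQ hn (g := g)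
  refine ⟨u, hu, fun hd => hne ?_⟩
  have hwu := (dvd_normForm_iff_of_double_root hp hu hd w).mp hw
  ext z
  obtain ⟨a, b, rfl⟩ := B.repr z
  rw [mem_prime_iff_of_root_mem hp hg hP hpP huP, mem_prime_iff_of_root_mem hp hg hQ hpQ hwQ]
  have e : g * a - b * u = (g * a - b * w) + (w - u) * b := by ring
  rw [e]
  exact dvd_add_left (hwu.mul_right b)

/-- The ideal (p) has norm p², so a maximal ideal above it has norm p, with a cofactor of norm p, or
norm p². -/
theorem inert_or_ramified_or_splits (hK : Module.finrank ℚ K = 2) (hp : p.Prime) :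
    Inert K p ∨ Ramified K p ∨ Splits K p := by
  have hnorm : Ideal.absNorm (extended K p) = p ^ 2 := by
    have hr : Module.finrank ℤ (NumberField.RingOfIntegers K) = 2 := by
      rw [NumberField.RingOfIntegers.rank, hK]
    have e : (p : NumberField.RingOfIntegers K) =
        algebraMap ℤ (NumberField.RingOfIntegers K) p := by simp
    rw [extended, Ideal.absNorm_span_singleton, e, Algebra.norm_algebraMap, hr, Int.natAbs_pow,
      Int.natAbs_natCast]
  have htop : extended K p ≠ ⊤ := by
    intro h
    rw [h, Ideal.absNorm_top] at hnorm
    exact (Nat.one_lt_pow two_ne_zero hp.one_lt).ne hnorm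
  obtain ⟨P, hP, hle⟩ := Ideal.exists_le_maximal _ htop
  obtain ⟨J, hJ⟩ := Ideal.dvd_iff_le.mpr hle
  have hmul : Ideal.absNorm P * Ideal.absNorm J = p ^ 2 := by rw [← map_mul, ← hJ, hnorm]
  obtain ⟨i, hi, hPi⟩ := (Nat.dvd_prime_pow hp).mp (Dvd.intro _ hmul)
  have hp2 : 0 < p ^ 2 := pow_pos hp.pos 2
  interval_cases i
  · exact absurd (Ideal.absNorm_eq_one_iff.mp (by simpa using hPi)) hP.ne_top
  · right
    have hJp : Ideal.absNorm J = p := by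
      rw [hPi, pow_one, sq] at hmul
      exact Nat.eq_of_mul_eq_mul_left hp.pos hmul
    have hJ' : J.IsPrime := Ideal.isPrime_of_irreducible_absNorm (hJp ▸ hp)
    by_cases hPJ : P = J
    · exact Or.inl ⟨P, hP.isPrime, by rw [sq, hJ, ← hPJ]⟩
    · exact Or.inr ⟨P, J, hP.isPrime, hJ', hPJ, hJ⟩
  · left
    have hJp : Ideal.absNorm J = 1 := by
      rw [hPi] at hmul
      exact Nat.eq_of_mul_eq_mul_left hp2 (by rw [hmul, mul_one])
    rw [Inert, hJ, Ideal.absNorm_eq_one_iff.mp hJp, Ideal.mul_top]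
    exact hP.isPrime

end NumberField

/-! ### The maximal order -/

/-- The trace of `ω`. -/
def omegaTrace (d : ℤ) : ℤ := if d % 4 = 1 then 1 else 0

/-- The norm of `ω`. -/
def omegaNorm (d : ℤ) : ℤ := if d % 4 = 1 then (1 - d) / 4 else -d

theorem isIntegral_of_sq_eq {K : Type*} [Field K] {y : K} {c e : ℤ} (h : y ^ 2 = c * y - e) : IsIntegral ℤ y := by
  refine ⟨Polynomial.X ^ 2 - Polynomial.C c * Polynomial.X + Polynomial.C e, ?_, ?_⟩
  · monicity!
  · simp only [Polynomial.eval₂_add, Polynomial.eval₂_sub, Polynomial.eval₂_mul,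
      Polynomial.eval₂_X_pow, Polynomial.eval₂_X, Polynomial.eval₂_C]
    simp only [algebraMap_int_eq, eq_intCast]
    linear_combination h

section

variable {K : Type*} [Field K] [NumberField K] {d : ℤ} {δ : K}

theorem omega_sq (hδ : δ ^ 2 = (d : K)) :
    omega d δ ^ 2 = omegaTrace d * omega d δ - omegaNorm d := by
  unfold omega omegaTrace omegaNorm
  split_ifs with h
  · obtain ⟨e, he⟩ : ∃ e, 1 - d = 4 * e := ⟨(1 - d) / 4, by omega⟩
    have h4 : (1 - d) / 4 = e := by omega
    rw [h4]
    have he' : (1 : K) - d = 4 * e := by exact_mod_cast congrArg (Int.cast (R := K)) he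
    push_cast
    linear_combination (1 / 4 : K) * hδ - (1 / 4 : K) * he'
  · push_cast
    linear_combination hδ

/-- The parity of ε makes τ - fω an integer, so τ and fω define the same family of lattices. -/
theorem exists_tau_eq (d : ℤ) (δ : K) (f : ℕ) :
    ∃ c : ℤ, tau d δ f = c + f * omega d δ := by
  unfold tau omega sqrtDK eps dK
  split_ifs with h
  · refine ⟨(((f : ℤ) * d) % 2 - f) / 2, ?_⟩
    have h2 : (2 : ℤ) ∣ ((f : ℤ) * d) % 2 - f := by
      have : ((f : ℤ) * d) % 2 = (f : ℤ) % 2 := by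
        rw [Int.mul_emod, show d % 2 = 1 by omega]; simp
      omega
    have h3 : (((((f : ℤ) * d) % 2 - f) / 2 : ℤ) : K) * 2 = (((f : ℤ) * d) % 2 : ℤ) - f := by
      exact_mod_cast congrArg (Int.cast (R := K)) (Int.ediv_mul_cancel h2)
    linear_combination (-1 / 2 : K) * h3
  · refine ⟨0, ?_⟩
    have h2 : ((f : ℤ) * (4 * d)) % 2 = 0 := by
      rw [show (f : ℤ) * (4 * d) = 2 * (2 * f * d) by ring]; simp
    rw [h2]
    push_cast; ring

theorem ne_ratCast_of_sq_eq (hd : Squarefree d) (hd1 : d ≠ 1) (hδ : δ ^ 2 = (d : K)) (q : ℚ) :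
    δ ≠ q := by
  rintro rfl
  have h : q ^ 2 = (d : ℚ) := by exact_mod_cast hδ
  have hsq : IsSquare (d : ℚ) := ⟨q, by rw [← h, sq]⟩
  obtain ⟨k, rfl⟩ := Rat.isSquare_intCast_iff.mp hsq
  rcases Int.isUnit_iff.mp (hd k dvd_rfl) with rfl | rfl <;> simp at hd1

theorem omega_indep (hd : Squarefree d) (hd1 : d ≠ 1) (hδ : δ ^ 2 = (d : K)) {a b : ℚ}
    (h : (a : K) + b * omega d δ = 0) : a = 0 ∧ b = 0 := by
  have hb : b = 0 := by
    by_contra hb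
    have hb' : (b : K) ≠ 0 := by exact_mod_cast hb
    have h1 : omega d δ = ((-a / b : ℚ) : K) := by
      push_cast; field_simp; linear_combination h
    unfold omega at h1
    split_ifs at h1
    · refine ne_ratCast_of_sq_eq hd hd1 hδ (2 * (-a / b) - 1) ?_
      push_cast at h1 ⊢
      linear_combination 2 * h1
    · exact ne_ratCast_of_sq_eq hd hd1 hδ _ h1
  subst hb
  exact ⟨by simpa using h, rfl⟩

theorem exists_basis_omega (hK : Module.finrank ℚ K = 2) (hd : Squarefree d) (hd1 : d ≠ 1)
    (hδ : δ ^ 2 = (d : K)) : ∃ b : Module.Basis (Fin 2) ℚ K, ⇑b = ![1, omega d δ] := by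
  have hli : LinearIndependent ℚ ![1, omega d δ] := by
    rw [LinearIndependent.pair_iff]
    intro s t h
    rw [Rat.smul_def, Rat.smul_def, mul_one] at h
    exact omega_indep hd hd1 hδ h
  exact ⟨basisOfLinearIndependentOfCardEqFinrank hli (by simp [hK]),
    coe_basisOfLinearIndependentOfCardEqFinrank hli _⟩

theorem exists_eq_add_mul_omega (hK : Module.finrank ℚ K = 2) (hd : Squarefree d) (hd1 : d ≠ 1)
    (hδ : δ ^ 2 = (d : K)) (y : K) : ∃ a b : ℚ, y = a + b * omega d δ := by
  obtain ⟨B, hB⟩ := exists_basis_omega hK hd hd1 hδ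
  refine ⟨B.repr y 0, B.repr y 1, ?_⟩
  have h := B.sum_repr y
  rw [Fin.sum_univ_two, hB] at h
  simpa [Rat.smul_def] using h.symm

theorem leftMulMatrix_omega (hδ : δ ^ 2 = (d : K))
    (B : Module.Basis (Fin 2) ℚ K) (hB : ⇑B = ![1, omega d δ]) (a b : ℚ) :
    Algebra.leftMulMatrix B (a + b * omega d δ) =
      !![a, -(b * omegaNorm d); b, a + b * omegaTrace d] := by
  have h0 : B 0 = 1 := by rw [hB]; rfl
  have h1 : B 1 = omega d δ := by rw [hB]; rfl
  have key : ∀ r s : ℚ, ∀ y : K, y = r + s * omega d δ → B.repr y 0 = r ∧ B.repr y 1 = s := by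
    rintro r s _ rfl
    have e : (r : K) + s * omega d δ = r • B 0 + s • B 1 := by
      rw [h0, h1, Rat.smul_def, Rat.smul_def, mul_one]
    rw [e, map_add, map_smul, map_smul, B.repr_self, B.repr_self]
    simp
  have k0 := key a b ((a + b * omega d δ) * B 0) (by rw [h0, mul_one])
  have k1 := key (-(b * omegaNorm d)) (a + b * omegaTrace d) ((a + b * omega d δ) * B 1) (by
    rw [h1]; push_cast
    linear_combination (b : K) * omega_sq hδ)
  ext i j
  rw [Algebra.leftMulMatrix_eq_repr_mul]
  fin_cases i <;> fin_cases j
  · exact k0.1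
  · exact k1.1
  · exact k0.2
  · exact k1.2

theorem norm_add_mul_omega (hK : Module.finrank ℚ K = 2) (hd : Squarefree d) (hd1 : d ≠ 1)
    (hδ : δ ^ 2 = (d : K)) (a b : ℚ) :
    Algebra.norm ℚ ((a : K) + b * omega d δ) = a ^ 2 + a * b * omegaTrace d + b ^ 2 * omegaNorm d := by
  obtain ⟨B, hB⟩ := exists_basis_omega hK hd hd1 hδ
  rw [Algebra.norm_eq_matrix_det B, leftMulMatrix_omega hδ B hB, Matrix.det_fin_two_of]
  ring

theorem trace_add_mul_omega (hK : Module.finrank ℚ K = 2) (hd : Squarefree d) (hd1 : d ≠ 1)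
    (hδ : δ ^ 2 = (d : K)) (a b : ℚ) :
    Algebra.trace ℚ K ((a : K) + b * omega d δ) = 2 * a + b * omegaTrace d := by
  obtain ⟨B, hB⟩ := exists_basis_omega hK hd hd1 hδ
  rw [Algebra.trace_eq_matrix_trace B, leftMulMatrix_omega hδ B hB, Matrix.trace_fin_two_of]
  ring

/-- The squared denominator of b must divide d. -/
theorem exists_intCast_eq_of_squarefree_mul_sq (hd : Squarefree d) {b : ℚ} {k : ℤ}
    (h : d * b ^ 2 = k) : ∃ n : ℤ, b = n := by
  have hden : (b.den : ℚ) ≠ 0 := by exact_mod_cast b.den_ne_zero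
  have h1 : d * b.num ^ 2 = k * (b.den : ℤ) ^ 2 := by
    have h2 : (d : ℚ) * b.num ^ 2 = k * (b.den : ℚ) ^ 2 := by
      rw [← h]; nth_rw 2 [← Rat.num_div_den b]; field_simp
    exact_mod_cast h2
  have hcop : IsCoprime ((b.den : ℤ) ^ 2) (b.num ^ 2) := by
    refine IsCoprime.pow (Int.isCoprime_iff_gcd_eq_one.mpr ?_)
    simpa [Int.gcd] using b.reduced.symm
  have h3 : (b.den : ℤ) * b.den ∣ d := by
    rw [← sq]
    exact hcop.dvd_of_dvd_mul_right (Dvd.intro_left _ h1.symm)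
  have h4 : b.den = 1 := by
    have := Int.isUnit_iff_natAbs_eq.mp (hd _ h3)
    simpa using this
  exact ⟨b.num, ((Rat.den_eq_one_iff b).mp h4).symm⟩

/-- With trace A and norm M, A² - 4M is d·b², respectively d·(2b)². Squarefreeness makes b,
respectively 2b, an integer, and parity does the rest. -/
theorem isIntegral_iff_exists_omega (hK : Module.finrank ℚ K = 2) (hd : Squarefree d)
    (hd1 : d ≠ 1) (hδ : δ ^ 2 = (d : K)) (y : K) :
    IsIntegral ℤ y ↔ ∃ a b : ℤ, y = a + b * omega d δ := by
  constructor
  · intro hy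
    obtain ⟨a, b, rfl⟩ := exists_eq_add_mul_omega hK hd hd1 hδ y
    obtain ⟨M, hM⟩ := IsIntegrallyClosed.isIntegral_iff.mp (Algebra.isIntegral_norm ℚ hy)
    obtain ⟨A, hA⟩ := IsIntegrallyClosed.isIntegral_iff.mp
      (Algebra.isIntegral_trace (L := ℚ) hy)
    rw [norm_add_mul_omega hK hd hd1 hδ] at hM
    rw [trace_add_mul_omega hK hd hd1 hδ] at hA
    simp only [algebraMap_int_eq, eq_intCast] at hM hA
    suffices h : ∃ r s : ℤ, a = r ∧ b = s by
      obtain ⟨r, s, rfl, rfl⟩ := h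
      exact ⟨r, s, by push_cast; rfl⟩
    simp only [omegaNorm, omegaTrace] at hM hA
    split_ifs at hM hA with h4
    · obtain ⟨e, he⟩ : ∃ e, d = 1 - 4 * e := ⟨(1 - d) / 4, by omega⟩
      rw [show (1 - d) / 4 = e by omega] at hM
      have he' : (d : ℚ) = 1 - 4 * e := by exact_mod_cast congrArg (Int.cast (R := ℚ)) he
      push_cast at hM hA
      obtain ⟨s, rfl⟩ := exists_intCast_eq_of_squarefree_mul_sq hd (b := b) (k := A ^ 2 - 4 * M) (by
        push_cast; rw [hM, hA, he']; ring)
      have hE : A ^ 2 - 4 * M = d * s ^ 2 := by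
        have : (A : ℚ) ^ 2 - 4 * M = d * s ^ 2 := by rw [hM, hA, he']; ring
        exact_mod_cast this
      have hpar : (A - s) % 2 = 0 := by
        have h5 : A ^ 2 - s ^ 2 = 2 * (2 * M - 2 * e * s ^ 2) := by
          rw [he] at hE; linear_combination hE
        have h6 : Even (A ^ 2 - s ^ 2) := by rw [h5]; exact even_two_mul _
        have h7 : Even (A - s) := by simpa [Int.even_sub, Int.even_pow] using h6
        exact Int.even_iff.mp h7
      refine ⟨(A - s) / 2, s, ?_, rfl⟩
      have h8 : (((A - s) / 2 : ℤ) : ℚ) * 2 = A - s := by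
        exact_mod_cast congrArg (Int.cast (R := ℚ)) (Int.ediv_mul_cancel (Int.dvd_of_emod_eq_zero hpar))
      linear_combination (1 / 2 : ℚ) * hA * (-1) - (1 / 2 : ℚ) * h8
    · push_cast at hM hA
      obtain ⟨s, hs⟩ := exists_intCast_eq_of_squarefree_mul_sq hd (b := 2 * b)
        (k := A ^ 2 - 4 * M) (by push_cast; rw [hM, hA]; ring)
      have hE : A ^ 2 - 4 * M = d * s ^ 2 := by
        have : (A : ℚ) ^ 2 - 4 * M = d * s ^ 2 := by rw [hM, hA, ← hs]; ring
        exact_mod_cast this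
      have hd0 : d % 4 ≠ 0 := fun h0 => by
        have := hd 2 (Int.dvd_of_emod_eq_zero h0)
        rw [Int.isUnit_iff] at this
        omega
      have hpar : A % 2 = 0 ∧ s % 2 = 0 := by
        -- A² - ds² = 4M is reduced modulo 4 to the finitely many values of A, s mod 2 and d mod 4.
        have h5 : ∃ k, (A % 2) ^ 2 - d % 4 * (s % 2) ^ 2 = 4 * k := by
          refine ⟨M - (A / 2) ^ 2 - (A / 2) * (A % 2) + d / 4 * s ^ 2 +
            d % 4 * ((s / 2) ^ 2 + (s / 2) * (s % 2)), ?_⟩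
          have e1 := Int.emod_add_mul_ediv A 2
          have e2 := Int.emod_add_mul_ediv s 2
          have e3 := Int.emod_add_mul_ediv d 4
          linear_combination hE + (A % 2 + 2 * (A / 2) + A) * e1 - s ^ 2 * e3 -
            d % 4 * (s % 2 + 2 * (s / 2) + s) * e2
        have hd23 : d % 4 = 2 ∨ d % 4 = 3 := by omega
        obtain ⟨k, hk⟩ := h5
        rcases hd23 with h | h <;> rcases Int.emod_two_eq_zero_or_one A with hA2 | hA2 <;>
          rcases Int.emod_two_eq_zero_or_one s with hs2 | hs2 <;>
          rw [h, hA2, hs2] at hk <;> omega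
      refine ⟨A / 2, s / 2, ?_, ?_⟩
      · have h8 : ((A / 2 : ℤ) : ℚ) * 2 = A := by
          exact_mod_cast congrArg (Int.cast (R := ℚ))
            (Int.ediv_mul_cancel (Int.dvd_of_emod_eq_zero hpar.1))
        linear_combination (-1 / 2 : ℚ) * hA - (1 / 2 : ℚ) * h8
      · have h8 : ((s / 2 : ℤ) : ℚ) * 2 = s := by
          exact_mod_cast congrArg (Int.cast (R := ℚ))
            (Int.ediv_mul_cancel (Int.dvd_of_emod_eq_zero hpar.2))
        linear_combination (1 / 2 : ℚ) * hs - (1 / 2 : ℚ) * h8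
  · rintro ⟨a, b, rfl⟩
    have hi : ∀ n : ℤ, IsIntegral ℤ (n : K) := fun n => isIntegral_algebraMap (x := n)
    exact (hi a).add ((hi b).mul (isIntegral_of_sq_eq (omega_sq hδ)))

theorem intCast_omega_indep (hd : Squarefree d) (hd1 : d ≠ 1) (hδ : δ ^ 2 = (d : K)) {a b : ℤ}
    (h : (a : K) + b * omega d δ = 0) : a = 0 ∧ b = 0 := by
  have := omega_indep hd hd1 hδ (a := a) (b := b) (by push_cast; exact h)
  exact_mod_cast this

theorem exists_quadBasis_ringOfIntegers (hK : Module.finrank ℚ K = 2) (hd : Squarefree d)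
    (hd1 : d ≠ 1) (hδ : δ ^ 2 = (d : K)) :
    ∃ w : NumberField.RingOfIntegers K, QuadBasis w (omegaTrace d) (omegaNorm d) := by
  obtain ⟨w, hw⟩ : ∃ w : NumberField.RingOfIntegers K,
      algebraMap (NumberField.RingOfIntegers K) K w = omega d δ :=
    ⟨⟨omega d δ, isIntegral_of_sq_eq (omega_sq hδ)⟩, rfl⟩
  refine ⟨w, ⟨?_, ?_, ?_⟩⟩
  · intro z
    obtain ⟨a, b, h⟩ := (isIntegral_iff_exists_omega hK hd hd1 hδ (z : K)).mp z.isIntegral_coe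
    exact ⟨a, b, NumberField.RingOfIntegers.ext (by simpa [hw] using h)⟩
  · intro a b h
    have h1 := congrArg (algebraMap (NumberField.RingOfIntegers K) K) h
    refine intCast_omega_indep hd hd1 hδ ?_
    simpa [hw] using h1
  · refine NumberField.RingOfIntegers.ext ?_
    simpa [hw] using omega_sq hδ

/-! ### The order of conductor `f` -/

variable {O : Subring K} {f : ℕ}

/-- If a + bω ∈ O, then bω ∈ O, so b·O_K ⊆ O. Thus b lies in the conductor and f ∣ b. -/
theorem exists_quadBasis_order (hK : Module.finrank ℚ K = 2) (hd : Squarefree d)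
    (hd1 : d ≠ 1) (hδ : δ ^ 2 = (d : K)) (hO : O ≤ (integralClosure ℤ K).toSubring)
    (hf : f ≠ 0) (hcond : HasConductor O f) :
    ∃ θ : O, (θ : K) = f * omega d δ ∧ QuadBasis θ (f * omegaTrace d) (f ^ 2 * omegaNorm d) := by
  have hw : IsIntegral ℤ (omega d δ) := isIntegral_of_sq_eq (omega_sq hδ)
  have hint := isIntegral_iff_exists_omega hK hd hd1 hδ
  have hfO : (f : K) ∈ conductor O := by
    rw [hcond]
    exact ⟨1, isIntegral_one, (mul_one _).symm⟩
  have hf' : (f : K) ≠ 0 := by exact_mod_cast hf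
  refine ⟨⟨f * omega d δ, hfO _ hw⟩, rfl, ⟨?_, ?_, ?_⟩⟩
  · rintro ⟨z, hz⟩
    obtain ⟨a, b, rfl⟩ := (hint z).mp (hO hz)
    have hbw : (b : K) * omega d δ ∈ O := by
      have := O.sub_mem hz (intCast_mem O a)
      rwa [add_sub_cancel_left] at this
    have hb : (b : K) ∈ conductor O := by
      intro y hy
      obtain ⟨r, s, rfl⟩ := (hint y).mp hy
      have e : (b : K) * (r + s * omega d δ) = (b * r : ℤ) + s * (b * omega d δ) := by
        push_cast; ring
      rw [e]
      exact O.add_mem (intCast_mem O _) (O.mul_mem (intCast_mem O _) hbw)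
    rw [hcond] at hb
    obtain ⟨y, hy, hby⟩ := hb
    obtain ⟨r, s, rfl⟩ := (hint y).mp hy
    have h1 := (intCast_omega_indep hd hd1 hδ (a := b - f * r) (b := -(f * s)) (by
      push_cast; linear_combination hby)).1
    obtain rfl : b = f * r := by linarith
    exact ⟨a, r, Subtype.ext (by push_cast; ring)⟩
  · intro a b h
    have h1 : (a : K) + b * (f * omega d δ) = 0 := by
      simpa using congrArg (Subtype.val) h
    have h2 := intCast_omega_indep hd hd1 hδ (a := a) (b := b * f) (by
      push_cast; linear_combination h1)
    have hfz : (f : ℤ) ≠ 0 := by exact_mod_cast hf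
    exact ⟨h2.1, (mul_eq_zero.mp h2.2).resolve_right hfz⟩
  · refine Subtype.ext ?_
    push_cast
    linear_combination (f : K) ^ 2 * omega_sq hδ

theorem normDvd_iff (hK : Module.finrank ℚ K = 2) (hd : Squarefree d) (hd1 : d ≠ 1)
    (hδ : δ ^ 2 = (d : K)) (n : ℕ) (x : ℤ) :
    NormDvd n ((x : K) + f * omega d δ) ↔
      (n : ℤ) ∣ normForm (f * omegaTrace d) (f ^ 2 * omegaNorm d) x := by
  have h := norm_add_mul_omega hK hd hd1 hδ x f
  push_cast at h
  have e : Algebra.norm ℚ ((x : K) + f * omega d δ) =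
      (normForm (f * omegaTrace d) (f ^ 2 * omegaNorm d) x : ℤ) := by
    rw [h]; unfold normForm; push_cast; ring
  unfold NormDvd
  rw [e]
  exact exists_congr fun k => by exact_mod_cast Iff.rfl

/-- Integral elements with norm divisible by `p²` and trace divisible by `p` are multiples of `p`. -/
theorem not_sq_dvd_normForm (hK : Module.finrank ℚ K = 2) (hd : Squarefree d) (hd1 : d ≠ 1)
    (hδ : δ ^ 2 = (d : K)) {p : ℕ} (hp : p.Prime) {g : ℤ} (hg : ¬ (p : ℤ) ∣ g) {u : ℤ}
    (hu : (p : ℤ) ∣ 2 * u + g * omegaTrace d) :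
    ¬ (p : ℤ) ^ 2 ∣ normForm (g * omegaTrace d) (g ^ 2 * omegaNorm d) u := by
  rintro ⟨e, he⟩
  obtain ⟨c, hc⟩ := hu
  have hp0 : (p : K) ≠ 0 := by exact_mod_cast hp.ne_zero
  have hc' : (2 * u + g * omegaTrace d : K) = p * c := by
    exact_mod_cast congrArg (Int.cast (R := K)) hc
  have he' : (u ^ 2 + g * omegaTrace d * u + g ^ 2 * omegaNorm d : K) = p ^ 2 * e := by
    unfold normForm at he
    exact_mod_cast congrArg (Int.cast (R := K)) he
  have hy : IsIntegral ℤ (((u : K) + g * omega d δ) / p) := by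
    refine isIntegral_of_sq_eq (c := c) (e := e) ?_
    field_simp
    linear_combination (g : K) ^ 2 * omega_sq hδ + ((u : K) + g * omega d δ) * hc' - he'
  obtain ⟨a, b, hab⟩ := (isIntegral_iff_exists_omega hK hd hd1 hδ _).mp hy
  rw [div_eq_iff hp0] at hab
  have h := (intCast_omega_indep hd hd1 hδ (a := u - a * p) (b := g - b * p) (by
    push_cast; linear_combination hab)).2
  exact hg ⟨b, by linarith⟩

end

/-! ### Finiteness and infinitude of the atoms. -/

theorem le_of_pow_dvd_normForm {p : ℕ} (hp : p.Prime) {v : ℕ} {T N : ℤ} {k : ℕ}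
    (h : ∀ u, ¬ (p : ℤ) ^ (k + 1) ∣ normForm T N u) {m : ℕ} {x : ℤ}
    (hx : (p : ℤ) ^ m ∣ normForm ((p : ℤ) ^ v * T) ((p : ℤ) ^ (2 * v) * N) x) :
    m ≤ 2 * v + k := by
  by_cases hxv : (p : ℤ) ^ v ∣ x
  · obtain ⟨u, rfl⟩ := hxv
    by_contra hm
    refine h u ?_
    have h1 := (pow_dvd_pow (p : ℤ) (show 2 * v + (k + 1) ≤ m by omega)).trans hx
    rw [mul_comm 2 v, pow_mul, normForm_scale, pow_add, pow_mul] at h1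
    exact Int.dvd_of_mul_dvd_mul_left
      (pow_ne_zero _ (pow_ne_zero _ (by exact_mod_cast hp.ne_zero))) h1
  · obtain ⟨j, hj, w, rfl, hw⟩ := exists_eq_pow_mul_of_not_pow_dvd hp hxv
    rw [pow_dvd_normForm_iff hp hj T N hw] at hx
    omega

section

variable {R : Type*} [CommRing R] [IsDomain R] {θ : R} {T N : ℤ} {p : ℕ} {P : Ideal R}

theorem IsLattice.finite_atoms (hP : IsLattice θ p 0 1 0 P) (B : QuadBasis θ T N) (hp : p.Prime)
    (hT : (p : ℤ) ∣ T) (hN : (p : ℤ) ∣ N) {M : ℕ}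
    (hM : ∀ (m : ℕ) (x : ℤ), (p : ℤ) ^ m ∣ normForm T N x → m ≤ M) :
    {q : Ideal R | IsIdealAtom q ∧ q.radical = P}.Finite := by
  have hfin : (⋃ m ∈ Set.Iic M, ⋃ x ∈ Set.Ico 0 ((p : ℤ) ^ m),
      {q : Ideal R | IsLattice θ p 0 m x q}).Finite := by
    refine (Set.finite_Iic M).biUnion fun m _ => (Set.finite_Ico 0 ((p : ℤ) ^ m)).biUnion
      fun x _ => Set.Subsingleton.finite ?_
    intro q hq q' hq'
    ext z
    rw [hq, hq']
  refine (hfin.union (Set.finite_singleton (Ideal.span {(p : R)}))).subset ?_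
  rintro q ⟨hq, hrad⟩
  obtain ⟨k, hk⟩ := ((hP.radical_eq_iff B hp hT hN).mp hrad).1
  obtain ⟨l, m, x, hx0, hx, h⟩ := B.exists_isLattice_of_pow_mem hp hk
  rcases h.eq_span_or_zero_of_isIdealAtom B hp hq with rfl | rfl
  · exact Or.inr rfl
  · refine Or.inl ?_
    simp only [Set.mem_iUnion]
    exact ⟨m, hM m x (h.pow_dvd_normForm B hp), x, ⟨hx0, hx⟩, h⟩

theorem IsLattice.infinite_invertible_atoms (hP : IsLattice θ p 0 1 0 P) (B : QuadBasis θ T N)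
    (hp : p.Prime) (hT : (p : ℤ) ∣ T) (hN : (p : ℤ) ^ 2 ∣ N) {M : ℕ}
    (hM : ∀ m ≥ M, (exactResidues p T N m).Nonempty) :
    {q : Ideal R | IsIdealAtom q ∧ Invertible q ∧ q.radical = P}.Infinite := by
  have hN1 := (dvd_pow_self _ two_ne_zero).trans hN
  -- The norms p^m of the atoms constructed below are unbounded.
  refine Set.Infinite.of_image idealNorm (Set.infinite_of_forall_exists_gt fun n => ?_)
  obtain ⟨x, hx⟩ := hM (M + n + 1) (by omega)
  have hx' := (Finset.mem_filter.mp hx).2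
  obtain ⟨q, h⟩ := B.exists_isLattice 0 hx'.1
  refine ⟨idealNorm q, ⟨q, ⟨hP.isIdealAtom h B hp hT hN (by omega),
    (h.invertible_iff B hp hT hN1).mpr (Or.inr hx'.2), ?_⟩, rfl⟩, ?_⟩
  · exact (hP.radical_eq_iff B hp hT hN1).mpr ⟨⟨_, h.pow_mem⟩, h.ne_top B hp (by omega)⟩
  · rw [h.idealNorm_eq B hp]
    exact lt_of_lt_of_le (by omega) (Nat.lt_pow_self hp.one_lt).le

end

/-! ### Ideals of the order as subsets of K. -/

section

variable {K : Type*} [Field K] {O : Subring K} {p l m : ℕ} {x : ℤ}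

theorem primaryLattice_add (c : ℤ) (y : K) :
    primaryLattice p (c + y) l m x = primaryLattice p y l m (x + c) := by
  unfold primaryLattice
  push_cast
  rw [add_assoc]

theorem lattice_eq_primaryLattice (y : K) : lattice (p : K) y = primaryLattice p y 0 1 0 := by
  ext z
  simp [primaryLattice]

theorem carrier_eq_primaryLattice_iff (θ : O) {q : Ideal O} :
    carrier q = primaryLattice p (θ : K) l m x ↔ IsLattice θ p l m x q := by
  have hmem : ∀ z : O, (z : K) ∈ carrier q ↔ z ∈ q := by
    intro z
    constructor
    · rintro ⟨w, hw, h⟩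
      rwa [← Subtype.ext h]
    · exact fun hz => ⟨z, hz, rfl⟩
  have hlat : ∀ z : O, (z : K) ∈ primaryLattice p (θ : K) l m x ↔
      ∃ s t : ℤ, z = (p : O) ^ l * ((p : O) ^ m * s + (x + θ) * t) := by
    intro z
    constructor
    · rintro ⟨_, ⟨s, t, rfl⟩, h⟩
      exact ⟨s, t, Subtype.ext (by push_cast; exact h)⟩
    · rintro ⟨s, t, rfl⟩
      exact ⟨_, ⟨s, t, rfl⟩, by push_cast; rfl⟩
  constructor
  · intro h z
    rw [← hmem, h, hlat]
  · intro h
    ext y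
    constructor
    · rintro ⟨z, hz, rfl⟩
      exact (hlat z).mpr ((h z).mp hz)
    · rintro ⟨_, ⟨s, t, rfl⟩, rfl⟩
      refine ⟨(p : O) ^ l * ((p : O) ^ m * s + (x + θ) * t), (h _).mpr ⟨s, t, rfl⟩, ?_⟩
      push_cast; rfl

theorem invAtoms_eq (θ : O) (c : ℤ) : invAtoms O p ((c : K) + θ) m =
    {I : Ideal O | IsIdealAtom I ∧ Invertible I ∧ idealNorm I = p ^ m ∧
      ∃ x : ℤ, IsLattice θ p 0 m x I} := by
  unfold invAtoms
  simp only [primaryLattice_add, carrier_eq_primaryLattice_iff]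
  have h : ∀ I : Ideal O, (∃ r : ℤ, IsLattice θ p 0 m (r + c) I) ↔
      ∃ x : ℤ, IsLattice θ p 0 m x I := fun I =>
    ⟨fun ⟨r, hr⟩ => ⟨_, hr⟩, fun ⟨x, hx⟩ => ⟨x - c, by rwa [sub_add_cancel]⟩⟩
  simp only [h]

theorem invAtoms_zero {τ : K} : invAtoms O p τ 0 = ∅ := by
  refine Set.eq_empty_of_forall_notMem ?_
  rintro I ⟨hI, -, hn, -⟩
  refine hI.2.not_isUnit (Ideal.isUnit_iff.mpr ?_)
  rw [idealNorm, pow_zero, Nat.card_eq_one_iff_unique] at hn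
  exact Ideal.Quotient.subsingleton_iff.mp hn.1

end

end QuadOrder

/-! ### Assembly of the theorem. -/

open QuadOrder in
theorem theorem3p6 {K : Type*} [Field K] [NumberField K] (hK : Module.finrank ℚ K = 2)
    (d : ℤ) (hd : Squarefree d) (hd1 : d ≠ 1) (δ : K) (hδ : δ ^ 2 = (d : K))
    (O : Subring K) (hO : QuadOrder.IsOrder O)
    (f : ℕ) (hf : 2 ≤ f) (hcond : QuadOrder.HasConductor O f)
    (p : ℕ) (hp : p.Prime) (hpf : p ∣ f)
    (τ : K) (hτ : τ = QuadOrder.tau d δ f)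
    (v : ℕ) (hv : v = padicValNat p f) :
    -- the ideal `𝔭 = pℤ + fωℤ`
    ∃ 𝔭 : Ideal O,
      QuadOrder.carrier 𝔭 = QuadOrder.lattice (p : K) ((f : K) * QuadOrder.omega d δ) ∧
      -- description of the primary ideals with radical `𝔭`, and their norms
      (∀ q : Ideal O, (q.IsPrimary ∧ q.radical = 𝔭) ↔
        ∃ (l m : ℕ) (r : ℤ), 1 ≤ l + m ∧ 0 ≤ r ∧ r < (p : ℤ) ^ m ∧
          QuadOrder.NormDvd (p ^ m) ((r : K) + τ) ∧
          QuadOrder.carrier q = QuadOrder.primaryLattice p τ l m r) ∧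
      (∀ (l m : ℕ) (r : ℤ), 1 ≤ l + m → 0 ≤ r → r < (p : ℤ) ^ m →
        QuadOrder.NormDvd (p ^ m) ((r : K) + τ) →
        ∃ q : Ideal O, QuadOrder.carrier q = QuadOrder.primaryLattice p τ l m r ∧
          QuadOrder.idealNorm q = p ^ (2 * l + m)) ∧
      -- invertibility
      (∀ (q : Ideal O) (l m : ℕ) (r : ℤ), q.IsPrimary → q.radical = 𝔭 →
        QuadOrder.carrier q = QuadOrder.primaryLattice p τ l m r →
        (QuadOrder.Invertible q ↔
          (m = 0 ∨ ¬ QuadOrder.NormDvd (p ^ (m + 1)) ((r : K) + τ)))) ∧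
      -- ideal atoms
      (∀ q : Ideal O, q.IsPrimary → q.radical = 𝔭 →
        (QuadOrder.IsIdealAtom q ↔
          (q = Ideal.span {(p : O)} ∨
            ∃ (m : ℕ) (r : ℤ), 1 ≤ m ∧ QuadOrder.NormDvd (p ^ m) ((r : K) + τ) ∧
              QuadOrder.carrier q = QuadOrder.primaryLattice p τ 0 m r))) ∧
      -- numbers of invertible ideal atoms of norm `p ^ m`
      (∀ h : ℕ, 1 ≤ h → h < v →
        (QuadOrder.invAtoms O p τ (2 * h)).encard = (Nat.totient (p ^ h) : ℕ)) ∧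
      (QuadOrder.Inert K p →
        (QuadOrder.invAtoms O p τ (2 * v)).encard = (p ^ v : ℕ) ∧
        ∀ m : ℕ, 2 * v + 1 ≤ m → (QuadOrder.invAtoms O p τ m).encard = 0) ∧
      (QuadOrder.Ramified K p →
        (QuadOrder.invAtoms O p τ (2 * v)).encard = (Nat.totient (p ^ v) : ℕ) ∧
        (QuadOrder.invAtoms O p τ (2 * v + 1)).encard = (p ^ v : ℕ) ∧
        ∀ m : ℕ, 2 * v + 1 < m → (QuadOrder.invAtoms O p τ m).encard = 0) ∧
      (QuadOrder.Splits K p →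
        (QuadOrder.invAtoms O p τ (2 * v)).encard = (p ^ (v - 1) * (p - 2) : ℕ) ∧
        ∀ m : ℕ, 2 * v + 1 ≤ m →
          (QuadOrder.invAtoms O p τ m).encard = (2 * Nat.totient (p ^ v) : ℕ)) ∧
      (∀ m : ℕ, m < 2 * v → (∀ h : ℕ, 1 ≤ h → h < v → m ≠ 2 * h) →
        (QuadOrder.invAtoms O p τ m).encard = 0) ∧
      -- finiteness
      ({q : Ideal O | QuadOrder.IsIdealAtom q ∧ q.radical = 𝔭}.Finite ↔
        {q : Ideal O | QuadOrder.IsIdealAtom q ∧ QuadOrder.Invertible q ∧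
          q.radical = 𝔭}.Finite) ∧
      ({q : Ideal O | QuadOrder.IsIdealAtom q ∧ QuadOrder.Invertible q ∧
          q.radical = 𝔭}.Finite ↔ ¬ QuadOrder.Splits K p) := by
  have := Fact.mk hp
  obtain ⟨θ, hθ, B⟩ := exists_quadBasis_order hK hd hd1 hδ hO.le (by omega) hcond
  obtain ⟨c, hc⟩ := exists_tau_eq d δ f
  obtain ⟨w, Bw⟩ := exists_quadBasis_ringOfIntegers hK hd hd1 hδ
  have hτ' : τ = c + θ := by rw [hτ, hc, hθ]
  have hf0 : f ≠ 0 := by omega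
  have hv1 : 1 ≤ v := hv ▸ one_le_padicValNat_of_dvd hf0 hpf
  obtain ⟨g, hg⟩ : p ^ v ∣ f := hv ▸ pow_padicValNat_dvd
  have hpg : ¬ (p : ℤ) ∣ g := by
    intro h
    refine pow_succ_padicValNat_not_dvd (p := p) hf0 ?_
    rw [← hv, hg, pow_succ]
    exact mul_dvd_mul_left _ (by exact_mod_cast h)
  set t := omegaTrace d
  set n := omegaNorm d
  have hT : (f : ℤ) * t = (p : ℤ) ^ v * (g * t) := by rw [hg]; push_cast; ring
  have hN : (f : ℤ) ^ 2 * n = (p : ℤ) ^ (2 * v) * ((g : ℤ) ^ 2 * n) := by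
    rw [hg]; push_cast; ring
  have hpT : (p : ℤ) ∣ f * t := (Int.natCast_dvd_natCast.mpr hpf).mul_right t
  have hpN2 : (p : ℤ) ^ 2 ∣ f ^ 2 * n :=
    (pow_dvd_pow_of_dvd (Int.natCast_dvd_natCast.mpr hpf) 2).mul_right n
  have hpN : (p : ℤ) ∣ f ^ 2 * n := (dvd_pow_self _ two_ne_zero).trans hpN2
  have hcar : ∀ (q : Ideal O) (l m : ℕ) (r : ℤ),
      carrier q = primaryLattice p τ l m r ↔ IsLattice θ p l m (r + c) q := by
    intro q l m r
    rw [hτ', primaryLattice_add, carrier_eq_primaryLattice_iff]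
  have hnd : ∀ (m : ℕ) (r : ℤ), NormDvd (p ^ m) ((r : K) + τ) ↔
      (p : ℤ) ^ m ∣ normForm (f * t) (f ^ 2 * n) (r + c) := by
    intro m r
    have h := normDvd_iff (f := f) hK hd hd1 hδ (p ^ m) (r + c)
    rw [hτ', hθ, ← add_assoc]
    push_cast at h
    exact h
  obtain ⟨P, hP⟩ : ∃ P : Ideal O, IsLattice θ p 0 1 0 P :=
    B.exists_isLattice 0 (by simpa [normForm] using hpN)
  have hrad : ∀ {q : Ideal O}, q.radical = P ↔ (∃ k : ℕ, (p : O) ^ k ∈ q) ∧ q ≠ ⊤ :=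
    hP.radical_eq_iff B hp hpT hpN
  have hcount : ∀ m : ℕ, 1 ≤ m → (invAtoms O p τ m).encard =
      ((exactResidues p ((p : ℤ) ^ v * (g * t)) ((p : ℤ) ^ (2 * v) * ((g : ℤ) ^ 2 * n)) m).card :
        ℕ) := by
    intro m hm
    rw [hτ', invAtoms_eq, hP.encard_invertible_atoms B hp hpT hpN2 hm, hT, hN]
  have hcount' : ∀ m : ℕ, 2 * v ≤ m → (invAtoms O p τ m).encard =
      ((exactLifts p (g * t) ((g : ℤ) ^ 2 * n) v (m - 2 * v)).card : ℕ) := by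
    intro m hm
    obtain ⟨k, rfl⟩ := Nat.exists_eq_add_of_le hm
    rw [hcount _ (by omega), card_exactResidues_add hp, Nat.add_sub_cancel_left]
  have hinert : Inert K p → ∀ u, ¬ (p : ℤ) ^ 1 ∣ normForm (g * t) ((g : ℤ) ^ 2 * n) u := by
    intro h u
    rw [pow_one]
    exact Bw.not_dvd_normForm_of_isPrime hpg h u
  have hram : Ramified K p → ∀ u, ¬ (p : ℤ) ^ 2 ∣ normForm (g * t) ((g : ℤ) ^ 2 * n) u := by
    intro h u hu
    obtain ⟨a, ha, ha'⟩ := h.exists_double_root Bw hp hpg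
    have h1 := (dvd_normForm_iff_of_double_root hp ha ha' u).mp
      ((dvd_pow_self _ two_ne_zero).trans hu)
    -- Every root u is congruent to the double root a, so the trace 2u + gt is also divisible by p.
    refine not_sq_dvd_normForm hK hd hd1 hδ hp hpg ?_ hu
    have e : 2 * u + g * t = 2 * (u - a) + (2 * a + g * t) := by ring
    rw [e]
    exact (h1.mul_left 2).add ha'
  have hsplit : Splits K p →
      {q : Ideal O | IsIdealAtom q ∧ Invertible q ∧ q.radical = P}.Infinite := by
    intro h
    obtain ⟨a, ha, ha'⟩ := h.exists_simple_root Bw hp hpg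
    refine hP.infinite_invertible_atoms B hp hpT hpN2 (M := 2 * v + 1) fun m hm => ?_
    obtain ⟨k, rfl⟩ := Nat.exists_eq_add_of_le (show 2 * v ≤ m by omega)
    rw [← Finset.card_pos, hT, hN, card_exactResidues_add hp,
      card_exactLifts_of_simple_root hp ha ha' hv1 (by omega)]
    exact Nat.mul_pos two_pos (Nat.totient_pos.mpr (pow_pos hp.pos v))
  have hnsplit : ¬ Splits K p → {q : Ideal O | IsIdealAtom q ∧ q.radical = P}.Finite := by
    intro h
    refine hP.finite_atoms B hp hpT hpN (M := 2 * v + 1) fun m x hx => ?_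
    rw [hT, hN] at hx
    refine le_of_pow_dvd_normForm hp (fun u hu => ?_) hx
    rcases inert_or_ramified_or_splits hK hp with h1 | h1 | h1
    · exact hinert h1 u ((pow_dvd_pow _ one_le_two).trans hu)
    · exact hram h1 u hu
    · exact h h1
  have hsub : {q : Ideal O | IsIdealAtom q ∧ Invertible q ∧ q.radical = P} ⊆
      {q : Ideal O | IsIdealAtom q ∧ q.radical = P} := fun q hq => ⟨hq.1, hq.2.2⟩
  refine ⟨P, ?_, ?_, ?_, ?_, ?_, ?_, ?_, ?_, ?_, ?_, ?_, ?_⟩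
  · rw [lattice_eq_primaryLattice, ← hθ, carrier_eq_primaryLattice_iff]
    exact hP
  · intro q
    constructor
    · rintro ⟨-, hq⟩
      obtain ⟨⟨k, hk⟩, htop⟩ := hrad.mp hq
      obtain ⟨l, m, x, -, -, h⟩ := B.exists_isLattice_of_pow_mem hp hk
      have hpm : (0 : ℤ) < (p : ℤ) ^ m := pow_pos (by exact_mod_cast hp.pos) _
      -- The reduction applies to x - c, not x, since r = x - c is the residue relative to τ.
      have h' : IsLattice θ p l m ((x - c) % (p : ℤ) ^ m + c) q := h.congr (by
        have := (Int.mod_modEq (x - c) ((p : ℤ) ^ m)).symm.dvd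
        convert this using 1; ring)
      exact ⟨l, m, (x - c) % (p : ℤ) ^ m, h.one_le_of_ne_top htop, Int.emod_nonneg _ hpm.ne',
        Int.emod_lt_of_pos _ hpm, (hnd _ _).mpr (h'.pow_dvd_normForm B hp), (hcar _ _ _ _).mpr h'⟩
    · rintro ⟨l, m, r, hlm, -, -, -, hq⟩
      rw [hcar] at hq
      have hr := hrad.mpr ⟨⟨_, hq.pow_mem⟩, hq.ne_top B hp hlm⟩
      exact ⟨hP.isPrimary_of_radical_eq B hp hr, hr⟩
  · intro l m r _ _ _ hnr
    obtain ⟨q, hq⟩ := B.exists_isLattice l ((hnd m r).mp hnr)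
    exact ⟨q, (hcar _ _ _ _).mpr hq, hq.idealNorm_eq B hp⟩
  · intro q l m r _ _ hq
    rw [hcar] at hq
    rw [hnd]
    exact hq.invertible_iff B hp hpT hpN
  · intro q _ hq
    constructor
    · intro hatom
      obtain ⟨⟨k, hk⟩, htop⟩ := hrad.mp hq
      obtain ⟨l, m, x, -, -, h⟩ := B.exists_isLattice_of_pow_mem hp hk
      rcases h.eq_span_or_zero_of_isIdealAtom B hp hatom with h1 | rfl
      · exact Or.inl h1
      · have hm := h.one_le_of_ne_top htop
        rw [← sub_add_cancel x c] at h
        exact Or.inr ⟨m, x - c, by omega, (hnd _ _).mpr (h.pow_dvd_normForm B hp),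
          (hcar _ _ _ _).mpr h⟩
    · rintro (rfl | ⟨m, r, hm, -, h⟩)
      · exact hP.isIdealAtom_span B hp hpT hpN2
      · exact hP.isIdealAtom ((hcar _ _ _ _).mp h) B hp hpT hpN2 hm
  · intro h h1 hhv
    rw [hcount _ (by omega), card_exactResidues_two_mul hp h1 hhv]
  · intro h
    refine ⟨?_, fun m hm => ?_⟩
    · rw [hcount' _ le_rfl, Nat.sub_self,
        card_exactLifts_zero_of_no_root (by simpa using hinert h)]
    · rw [hcount' _ (by omega), exactLifts_eq_empty_of_not_dvd (i := 1) (by omega) (hinert h)]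
      simp
  · intro h
    obtain ⟨a, ha, ha'⟩ := h.exists_double_root Bw hp hpg
    refine ⟨?_, ?_, fun m hm => ?_⟩
    · rw [hcount' _ le_rfl, Nat.sub_self, card_exactLifts_zero_of_double_root hp ha ha' hv1]
    · rw [hcount' _ (by omega), Nat.add_sub_cancel_left,
        card_exactLifts_one_of_double_root hp ha ha' (hram h)]
    · rw [hcount' _ (by omega), exactLifts_eq_empty_of_not_dvd (i := 2) (by omega) (hram h)]
      simp
  · intro h
    obtain ⟨a, ha, ha'⟩ := h.exists_simple_root Bw hp hpg
    refine ⟨?_, fun m hm => ?_⟩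
    · rw [hcount' _ le_rfl, Nat.sub_self, card_exactLifts_zero_of_simple_root hp ha ha' hv1]
    · rw [hcount' _ (by omega), card_exactLifts_of_simple_root hp ha ha' hv1 (by omega)]
  · intro m hm hne
    rcases Nat.eq_zero_or_pos m with rfl | hm1
    · rw [invAtoms_zero, Set.encard_empty]
    · rw [hcount _ hm1, exactResidues_eq_empty hp hm1 hm hne]
      simp
  · exact ⟨fun h => h.subset hsub, fun h => hnsplit fun hs => hsplit hs h⟩
  · exact ⟨fun h hs => hsplit hs h, fun h => (hnsplit h).subset hsub⟩
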